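/- Let $\Omega=[a_1,b_1]\times[a_2,b_2]\times[a_3,b_3]\subset\mathbb R^3$ with $a_i<b_i$, let $K\in\mathbb R$, and let $u\in C^8(\Omega)$ and $f$ be real functions satisfying the Helmholtz equation $\partial_x^2u+\partial_y^2u+\partial_z^2u+K^2u=f$ on $\Omega$ (so that $f\in C^6(\Omega)$). Derivatives at points of $\partial\Omega$ are taken within $\Omega$. For $h>0$ let $\delta_x^2\varphi(x,y,z)=h^{-2}\big(\varphi(x-h,y,z)-2\varphi(x,y,z)+\varphi(x+h,y,z)\big)$, similarly $\delta_y^2,\delta_z^2$; products of these denote compositions. Put $$\begin{aligned}\mathcal L_hu={}&C_1(\delta_x^2+\delta_y^2+\delta_z^2)u+C_2(\delta_x^2\delta_y^2+\delta_y^2\delta_z^2+\delta_x^2\delta_z^2)u+C_3\,\delta_x^2\delta_y^2\delta_z^2u+C_4u,\\ \mathcal R_hf={}&D_1f+D_2(\delta_x^2+\delta_y^2+\delta_z^2)f+D_3(\delta_x^2\delta_y^2+\delta_y^2\delta_z^2+\delta_x^2\delta_z^2)f\\&+D_4(\partial_x^2+\partial_y^2+\partial_z^2)f+D_5(\delta_x^2\partial_x^2+\delta_y^2\partial_y^2+\delta_z^2\partial_z^2)f,\end{aligned}$$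 $$\begin{gathered}C_1=1+\tfrac{K^6h^6}{20160},\quad C_2=\tfrac{h^2}{6}\Big(1+\tfrac{K^2h^2}{30}+\tfrac{K^4h^4}{840}\Big),\quad C_3=\tfrac{h^4}{30}\Big(1+\tfrac{17K^2h^2}{252}\Big),\quad C_4=K^2\Big(1-\tfrac{K^2h^2}{12}+\tfrac{K^4h^4}{360}\Big),\\ D_1=1-\tfrac{K^2h^2}{12}+\tfrac{K^4h^4}{360},\quad D_2=\tfrac{K^4h^6}{20160},\quad D_3=\tfrac{h^4}{90}\Big(1+\tfrac{K^2h^2}{112}\Big),\\ D_4=\tfrac{h^2}{12}\Big(1-\tfrac{K^2h^2}{30}\Big),\quad D_5=\tfrac{h^4}{360}\Big(1-\tfrac{K^2h^2}{56}\Big).\end{gathered}$$ The scheme is $\mathcal L_hU=\mathcal R_hf$. Define the following expression, in which $K$ does not appear: $$\begin{aligned}T_h={}&\tfrac{h^6}{3024}\big(\partial_x^4\partial_y^4+\partial_y^4\partial_z^4+\partial_x^4\partial_z^4\big)u-\tfrac{31h^6}{60480}\big(\partial_x^4\partial_y^2+\partial_x^2\partial_y^4+\partial_y^4\partial_z^2+\partial_y^2\partial_z^4+\partial_x^4\partial_z^2+\partial_x^2\partial_z^4\big)f\\&+\tfrac{59h^6}{30240}\,\partial_x^2\partial_y^2\partial_z^2f-\tfrac{11h^6}{60480}\big(\partial_x^6+\partial_y^6+\partial_z^6\big)f.\end{aligned}$$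 Then: 1. The scheme is compact: $\mathcal L_hu(p)$ depends only on the values of $u$, and $\mathcal R_hf(p)$ only on the values of $f,\partial_x^2f,\partial_y^2f,\partial_z^2f$, at the 27 points $p+h\{-1,0,1\}^3$. 2. The scheme is consistent of sixth order with leading truncation error $T_h$, uniformly over all $p$ whose 27-point stencil $p+h\{-1,0,1\}^3$ lies in $\Omega$ (in particular over the interior nodes of any uniform grid of $\Omega$ with step $h$): $\mathcal L_hu(p)-\mathcal R_hf(p)=O(h^6)$ and $T_h(p)=O(h^6)$, and, as $h\to0$, $\mathcal L_hu(p)-\mathcal R_hf(p)=T_h(p)+o(h^6)$. 3. If moreover $u\in C^{10}(\Omega)$, then, uniformly over the same $p$, $\mathcal L_hu(p)-\mathcal R_hf(p)=T_h(p)+O(h^8)$. The implied constants may depend on $\Omega,K,u,f$, but not on $h$ or $p$. -/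

import Mathlib

noncomputable section

namespace Helmholtz3D

/-- Points of three-dimensional space; the coordinates `0, 1, 2` are `x, y, z`. -/
abbrev Point : Type := Fin 3 → ℝ

/-! ### Partial derivatives on a closed box -/

/-- The first partial derivative `∂_i φ` on `Ω` (one-sided at boundary points of a closed box). -/
def pderiv (Ω : Set Point) (i : Fin 3) (φ : Point → ℝ) : Point → ℝ :=
  fun p => fderivWithin ℝ φ Ω p (Pi.single i 1)

/-- The pure partial derivative `∂_i^n φ` on `Ω`. -/
def purePartial (Ω : Set Point) (i : Fin 3) (n : ℕ) (φ : Point → ℝ) : Point → ℝ :=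
  (pderiv Ω i)^[n] φ

/-- The mixed partial derivative `∂_x^r ∂_y^s ∂_z^t φ` on `Ω`. -/
def mixedPartial (Ω : Set Point) (r s t : ℕ) (φ : Point → ℝ) : Point → ℝ :=
  purePartial Ω 0 r (purePartial Ω 1 s (purePartial Ω 2 t φ))

/-- `∇^n φ = ∂_x^n φ + ∂_y^n φ + ∂_z^n φ`; in particular `∇^2` is the Laplacian. -/
def nabla (Ω : Set Point) (n : ℕ) (φ : Point → ℝ) (p : Point) : ℝ :=
  ∑ i : Fin 3, purePartial Ω i n φ p

/-- The Helmholtz equation `∇²u + K²u = f` on `Ω`. -/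
def IsHelmholtzSolution (Ω : Set Point) (K : ℝ) (u f : Point → ℝ) : Prop :=
  ∀ p ∈ Ω, nabla Ω 2 u p + K ^ 2 * u p = f p

/-! ### Compact difference operators with step `h` in every direction -/

/-- The `27` points of the compact cell stencil centred at `p`. -/
def stencil27 (h : ℝ) (p : Point) : Set Point :=
  {q | ∀ i, q i = p i - h ∨ q i = p i ∨ q i = p i + h}

/-- The second central difference `δ_i²`. -/
def delta2 (h : ℝ) (i : Fin 3) (φ : Point → ℝ) : Point → ℝ :=
  fun p => (φ (p - Pi.single i h) - 2 * φ p + φ (p + Pi.single i h)) / h ^ 2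

/-- `δ_x² + δ_y² + δ_z²`. -/
def deltaSum (h : ℝ) (φ : Point → ℝ) (p : Point) : ℝ :=
  delta2 h 0 φ p + delta2 h 1 φ p + delta2 h 2 φ p

/-- `δ_x²δ_y² + δ_y²δ_z² + δ_x²δ_z²`. -/
def deltaPairSum (h : ℝ) (φ : Point → ℝ) (p : Point) : ℝ :=
  delta2 h 0 (delta2 h 1 φ) p + delta2 h 1 (delta2 h 2 φ) p + delta2 h 0 (delta2 h 2 φ) p

/-- `δ_x²δ_y²δ_z²`. -/
def deltaTriple (h : ℝ) (φ : Point → ℝ) (p : Point) : ℝ :=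
  delta2 h 0 (delta2 h 1 (delta2 h 2 φ)) p

/-- `δ_x²∂_x² + δ_y²∂_y² + δ_z²∂_z²`. -/
def deltaPartialSum (Ω : Set Point) (h : ℝ) (φ : Point → ℝ) (p : Point) : ℝ :=
  ∑ i : Fin 3, delta2 h i (purePartial Ω i 2 φ) p

/-! ### The coefficients of the scheme -/

def C1 (K h : ℝ) : ℝ := 1 + K ^ 6 * h ^ 6 / 20160

def C2 (K h : ℝ) : ℝ := h ^ 2 / 6 * (1 + K ^ 2 * h ^ 2 / 30 + K ^ 4 * h ^ 4 / 840)

def C3 (K h : ℝ) : ℝ := h ^ 4 / 30 * (1 + 17 * K ^ 2 * h ^ 2 / 252)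

def C4 (K h : ℝ) : ℝ := K ^ 2 * (1 - K ^ 2 * h ^ 2 / 12 + K ^ 4 * h ^ 4 / 360)

def D1 (K h : ℝ) : ℝ := 1 - K ^ 2 * h ^ 2 / 12 + K ^ 4 * h ^ 4 / 360

def D2 (K h : ℝ) : ℝ := K ^ 4 * h ^ 6 / 20160

def D3 (K h : ℝ) : ℝ := h ^ 4 / 90 * (1 + K ^ 2 * h ^ 2 / 112)

def D4 (K h : ℝ) : ℝ := h ^ 2 / 12 * (1 - K ^ 2 * h ^ 2 / 30)

def D5 (K h : ℝ) : ℝ := h ^ 4 / 360 * (1 - K ^ 2 * h ^ 2 / 56)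

/-! ### The scheme and its truncation error -/

/-- Left-hand side of the scheme, applied to `u` at the node `p`. -/
def schemeLHS (K h : ℝ) (u : Point → ℝ) (p : Point) : ℝ :=
  C1 K h * deltaSum h u p + C2 K h * deltaPairSum h u p + C3 K h * deltaTriple h u p
    + C4 K h * u p

/-- Right-hand side of the scheme, applied to the source `f` at the node `p`. -/
def schemeRHS (Ω : Set Point) (K h : ℝ) (f : Point → ℝ) (p : Point) : ℝ :=
  D1 K h * f p + D2 K h * deltaSum h f p + D3 K h * deltaPairSum h f p
    + D4 K h * nabla Ω 2 f p + D5 K h * deltaPartialSum Ω h f p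

/-- The local truncation error: the amount by which `u` fails to satisfy the scheme at `p`. -/
def truncationError (Ω : Set Point) (K h : ℝ) (u f : Point → ℝ) (p : Point) : ℝ :=
  schemeLHS K h u p - schemeRHS Ω K h f p

/-- The leading truncation error term; the wave number is not among its arguments. -/
def leadingError (Ω : Set Point) (h : ℝ) (u f : Point → ℝ) (p : Point) : ℝ :=
  h ^ 6 / 3024 *
      (mixedPartial Ω 4 4 0 u p + mixedPartial Ω 0 4 4 u p + mixedPartial Ω 4 0 4 u p)
    - 31 * h ^ 6 / 60480 *
      (mixedPartial Ω 4 2 0 f p + mixedPartial Ω 2 4 0 f p + mixedPartial Ω 0 4 2 f p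
        + mixedPartial Ω 0 2 4 f p + mixedPartial Ω 4 0 2 f p + mixedPartial Ω 2 0 4 f p)
    + 59 * h ^ 6 / 30240 * mixedPartial Ω 2 2 2 f p
    - 11 * h ^ 6 / 60480 * nabla Ω 6 f p

end Helmholtz3D

end

noncomputable section

namespace Helmholtz3D

open Finset Set Filter Topology Asymptotics

/-! ### Calculus of partial derivatives within a set -/

/-! After multiplication by `h ^ 2` the scheme becomes a combination of undivided central
differences with coefficients polynomial in `h`. Each difference is replaced by its even Taylor
polynomial, truncated so that only derivatives of `u` of order at most 8 and of `f` of order at most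
6 occur. The differentiated Helmholtz equation turns every derivative of `f` into derivatives of
`u`. What remains is a polynomial identity in `K`, `h` and the numbers `∂_x^r ∂_y^s ∂_z^t u p`: the
scheme's coefficients are such that everything collapses to the leading error plus `h ^ 8 *
residual`. This is `sq_mul_truncationError_sub_leadingError`, proved by `ring`.

The analytic part is the control of the Taylor remainders under minimal smoothness. Differentiating
a second difference twice along its line gives the second difference of `∂_i² φ`, up to the constant
that the Taylor polynomial accounts for, so a bound on second differences of the top derivative
integrates up to a remainder bound (`abs_secondDiff_sub_evenTaylor_le`). Composed differences are
treated one direction at a time (`HasGauge.exists_iterDiff_bound`).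

Both regularity classes follow from one estimate, `C * (ω h * h ^ 6)`, in which the gauge `ω`
measures second differences of the eighth derivatives of `u`. For `u` of class `C^8`, uniform
continuity on the compact box gives `ω h → 0` (`exists_gauge`); for class `C^10` one may take `ω h =
h ^ 2` (`hasGauge_sq`). A gauge must dominate `h ^ 2` so that the `residual` term and the
lower-order term `K ^ 2 * u` of the equation are absorbed as well. -/

theorem pderiv_congr {Ω : Set Point} {φ ψ : Point → ℝ} (h : EqOn φ ψ Ω) (i : Fin 3) :
    EqOn (pderiv Ω i φ) (pderiv Ω i ψ) Ω := by
  intro p hp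
  simp only [pderiv]
  rw [fderivWithin_congr h (h hp)]

theorem contDiffOn_pderiv {Ω : Set Point} (hΩ : UniqueDiffOn ℝ Ω) {n : ℕ} {φ : Point → ℝ}
    (h : ContDiffOn ℝ (n + 1 : ℕ) φ Ω) (i : Fin 3) : ContDiffOn ℝ n (pderiv Ω i φ) Ω := by
  have h1 : ContDiffOn ℝ n (fderivWithin ℝ φ Ω) Ω := h.fderivWithin hΩ (by norm_cast)
  exact h1.clm_apply contDiffOn_const

theorem pderiv_add {Ω : Set Point} (hΩ : UniqueDiffOn ℝ Ω) {φ ψ : Point → ℝ}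
    (hφ : ContDiffOn ℝ (1 : ℕ) φ Ω) (hψ : ContDiffOn ℝ (1 : ℕ) ψ Ω) (i : Fin 3) :
    EqOn (pderiv Ω i (fun p => φ p + ψ p)) (fun p => pderiv Ω i φ p + pderiv Ω i ψ p) Ω := by
  intro p hp
  have h := fderivWithin_fun_add (hΩ p hp) (hφ.differentiableOn (by simp) p hp)
    (hψ.differentiableOn (by simp) p hp)
  simp only [pderiv, h, add_apply]

theorem pderiv_const_mul {Ω : Set Point} (hΩ : UniqueDiffOn ℝ Ω) {φ : Point → ℝ}
    (hφ : ContDiffOn ℝ (1 : ℕ) φ Ω) (c : ℝ) (i : Fin 3) :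
    EqOn (pderiv Ω i (fun p => c * φ p)) (fun p => c * pderiv Ω i φ p) Ω := by
  intro p hp
  have h := fderivWithin_const_mul (hΩ p hp) (hφ.differentiableOn (by simp) p hp) c
  simp only [pderiv, h, smul_apply, smul_eq_mul]

/-- Both iterated partials are values of the second derivative within `Ω`. It is symmetric even at
boundary points because these are limits of interior points, which is the role of `hcl`. -/
theorem pderiv_comm {Ω : Set Point} (hΩ : UniqueDiffOn ℝ Ω) (hcl : Ω ⊆ closure (interior Ω))
    {φ : Point → ℝ} (hφ : ContDiffOn ℝ (2 : ℕ) φ Ω) (i j : Fin 3) :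
    EqOn (pderiv Ω i (pderiv Ω j φ)) (pderiv Ω j (pderiv Ω i φ)) Ω := by
  intro p hp
  have hs : IsSymmSndFDerivWithinAt ℝ φ Ω p :=
    (hφ p hp).isSymmSndFDerivWithinAt (by simp) hΩ (hcl hp) hp
  have hd : DifferentiableWithinAt ℝ (fderivWithin ℝ φ Ω) Ω p :=
    (hφ.fderivWithin (m := 1) hΩ (by norm_cast)).differentiableOn (by simp) p hp
  have key : ∀ k l : Fin 3, pderiv Ω k (pderiv Ω l φ) p
      = fderivWithin ℝ (fderivWithin ℝ φ Ω) Ω p (Pi.single k 1) (Pi.single l 1) := by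
    intro k l
    have h := fderivWithin_clm_apply (hΩ p hp) hd
      (differentiableWithinAt_const (Pi.single l (1 : ℝ) : Point))
    change fderivWithin ℝ (fun y => fderivWithin ℝ φ Ω y (Pi.single l 1)) Ω p _ = _
    rw [h]
    simp
  rw [key, key, hs]

theorem hasDerivWithinAt_line {Ω : Set Point} {φ : Point → ℝ} (hφ : ContDiffOn ℝ (1 : ℕ) φ Ω)
    (i : Fin 3) (q : Point) {S : Set ℝ} (hS : ∀ t ∈ S, q + Pi.single i t ∈ Ω) {t : ℝ}
    (ht : t ∈ S) :
    HasDerivWithinAt (fun t => φ (q + Pi.single i t)) (pderiv Ω i φ (q + Pi.single i t)) S t := by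
  have h1 : HasFDerivWithinAt φ (fderivWithin ℝ φ Ω (q + Pi.single i t)) Ω
      (q + Pi.single i t) :=
    (hφ.differentiableOn (by simp) _ (hS t ht)).hasFDerivWithinAt
  have h2 : HasDerivWithinAt (fun t : ℝ => q + (Pi.single i t : Point))
      (Pi.single i (1 : ℝ)) S t := by
    have := (hasDerivAt_single (𝕜 := ℝ) i t).const_add q
    exact this.hasDerivWithinAt
  exact h1.comp_hasDerivWithinAt t h2 hS

theorem hasDerivWithinAt_line_neg {Ω : Set Point} {φ : Point → ℝ}
    (hφ : ContDiffOn ℝ (1 : ℕ) φ Ω)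
    (i : Fin 3) (q : Point) {S : Set ℝ} (hS : ∀ t ∈ S, q - Pi.single i t ∈ Ω) {t : ℝ}
    (ht : t ∈ S) :
    HasDerivWithinAt (fun t => φ (q - Pi.single i t)) (-pderiv Ω i φ (q - Pi.single i t)) S t := by
  have h1 : HasFDerivWithinAt φ (fderivWithin ℝ φ Ω (q - Pi.single i t)) Ω
      (q - Pi.single i t) :=
    (hφ.differentiableOn (by simp) _ (hS t ht)).hasFDerivWithinAt
  have h2 : HasDerivWithinAt (fun t : ℝ => q - (Pi.single i t : Point))
      (-Pi.single i (1 : ℝ)) S t := by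
    have := (hasDerivAt_single (𝕜 := ℝ) i t).const_sub q
    exact this.hasDerivWithinAt
  have := h1.comp_hasDerivWithinAt t h2 hS
  rw [map_neg] at this
  exact this

/-! ### Iterated partial derivatives -/

theorem purePartial_add_order (Ω : Set Point) (i : Fin 3) (m n : ℕ) (φ : Point → ℝ) :
    purePartial Ω i (m + n) φ = purePartial Ω i m (purePartial Ω i n φ) :=
  Function.iterate_add_apply _ _ _ _

theorem purePartial_congr {Ω : Set Point} {φ ψ : Point → ℝ} (h : EqOn φ ψ Ω) (i : Fin 3) (n : ℕ) :
    EqOn (purePartial Ω i n φ) (purePartial Ω i n ψ) Ω := by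
  induction n generalizing φ ψ with
  | zero => exact h
  | succ n ih => exact ih (pderiv_congr h i)

theorem contDiffOn_purePartial {Ω : Set Point} (hΩ : UniqueDiffOn ℝ Ω) {n k : ℕ}
    {φ : Point → ℝ} (h : ContDiffOn ℝ (n + k : ℕ) φ Ω) (i : Fin 3) :
    ContDiffOn ℝ n (purePartial Ω i k φ) Ω := by
  induction k generalizing φ with
  | zero => exact h
  | succ k ih => exact ih (contDiffOn_pderiv hΩ h i)

theorem purePartial_add {Ω : Set Point} (hΩ : UniqueDiffOn ℝ Ω) {n : ℕ} {φ ψ : Point → ℝ}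
    (hφ : ContDiffOn ℝ n φ Ω) (hψ : ContDiffOn ℝ n ψ Ω) (i : Fin 3) :
    EqOn (purePartial Ω i n (fun p => φ p + ψ p))
      (fun p => purePartial Ω i n φ p + purePartial Ω i n ψ p) Ω := by
  induction n generalizing φ ψ with
  | zero => exact fun p _ => rfl
  | succ n ih =>
    have h1 : ((1 : ℕ) : WithTop ℕ∞) ≤ ((n + 1 : ℕ) : WithTop ℕ∞) := by norm_cast; omega
    exact (purePartial_congr (pderiv_add hΩ (hφ.of_le h1) (hψ.of_le h1) i) i n).trans
      (ih (contDiffOn_pderiv hΩ hφ i) (contDiffOn_pderiv hΩ hψ i))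

theorem purePartial_const_mul {Ω : Set Point} (hΩ : UniqueDiffOn ℝ Ω) {n : ℕ} {φ : Point → ℝ}
    (hφ : ContDiffOn ℝ n φ Ω) (c : ℝ) (i : Fin 3) :
    EqOn (purePartial Ω i n (fun p => c * φ p)) (fun p => c * purePartial Ω i n φ p) Ω := by
  induction n generalizing φ with
  | zero => exact fun p _ => rfl
  | succ n ih =>
    have h1 : ((1 : ℕ) : WithTop ℕ∞) ≤ ((n + 1 : ℕ) : WithTop ℕ∞) := by norm_cast; omega
    exact (purePartial_congr (pderiv_const_mul hΩ (hφ.of_le h1) c i) i n).trans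
      (ih (contDiffOn_pderiv hΩ hφ i))

theorem pderiv_purePartial_comm {Ω : Set Point} (hΩ : UniqueDiffOn ℝ Ω)
    (hcl : Ω ⊆ closure (interior Ω)) {n : ℕ} {φ : Point → ℝ}
    (hφ : ContDiffOn ℝ (n + 1 : ℕ) φ Ω) (i j : Fin 3) :
    EqOn (pderiv Ω i (purePartial Ω j n φ)) (purePartial Ω j n (pderiv Ω i φ)) Ω := by
  induction n generalizing φ with
  | zero => exact fun p _ => rfl
  | succ n ih =>
    have h1 : ((2 : ℕ) : WithTop ℕ∞) ≤ ((n + 1 + 1 : ℕ) : WithTop ℕ∞) := by norm_cast; omega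
    exact (ih (contDiffOn_pderiv hΩ hφ j)).trans
      (purePartial_congr (pderiv_comm hΩ hcl (hφ.of_le h1) i j) j n)

theorem purePartial_comm {Ω : Set Point} (hΩ : UniqueDiffOn ℝ Ω)
    (hcl : Ω ⊆ closure (interior Ω)) {m n : ℕ} {φ : Point → ℝ}
    (hφ : ContDiffOn ℝ (n + m : ℕ) φ Ω) (i j : Fin 3) :
    EqOn (purePartial Ω i m (purePartial Ω j n φ)) (purePartial Ω j n (purePartial Ω i m φ)) Ω := by
  induction m generalizing φ with
  | zero => exact fun p _ => rfl
  | succ m ih =>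
    have h1 : ((n + 1 : ℕ) : WithTop ℕ∞) ≤ ((n + (m + 1) : ℕ) : WithTop ℕ∞) := by
      norm_cast; omega
    exact (purePartial_congr (pderiv_purePartial_comm hΩ hcl (hφ.of_le h1) i j) i m).trans
      (ih (contDiffOn_pderiv hΩ hφ i))

/-! ### Taylor expansion of the second difference -/

/-- The undivided second central difference `h² δ_i²`. -/
def secondDiff (h : ℝ) (i : Fin 3) (φ : Point → ℝ) : Point → ℝ :=
  fun p => φ (p - Pi.single i h) - 2 * φ p + φ (p + Pi.single i h)

/-- The Taylor polynomial of `secondDiff h i φ p` of order `2k` in `h`. -/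
def evenTaylor (Ω : Set Point) (i : Fin 3) (k : ℕ) (φ : Point → ℝ) (h : ℝ) (p : Point) : ℝ :=
  ∑ j ∈ range k, 2 * (h ^ (2 * j + 2) / (2 * j + 2).factorial) * purePartial Ω i (2 * j + 2) φ p

/-- Mean value inequality on `[0, t]`, where `B * s ^ m ≤ B * t ^ m`. The factor `1 / (m + 1)` that
integration would give is discarded, since constants play no role. -/
theorem abs_le_mul_pow_succ_of_deriv {R R' : ℝ → ℝ} {h B : ℝ} {m : ℕ} (hB : 0 ≤ B)
    (hR : ∀ t ∈ Icc 0 h, HasDerivWithinAt R (R' t) (Icc 0 h) t) (h0 : R 0 = 0)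
    (hR' : ∀ t ∈ Icc 0 h, |R' t| ≤ B * t ^ m) {t : ℝ} (ht : t ∈ Icc 0 h) :
    |R t| ≤ B * t ^ (m + 1) := by
  have hsub : Icc 0 t ⊆ Icc 0 h := Icc_subset_Icc_right ht.2
  have := (convex_Icc 0 t).norm_image_sub_le_of_norm_hasDerivWithin_le
    (f := R) (f' := R') (C := B * t ^ m) (x := 0) (y := t)
    (fun s hs => (hR s (hsub hs)).mono hsub)
    (fun s hs => (hR' s (hsub hs)).trans
      (mul_le_mul_of_nonneg_left (pow_le_pow_left₀ hs.1 hs.2 m) hB))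
    ⟨le_rfl, ht.1⟩ ⟨ht.1, le_rfl⟩
  simpa [h0, abs_of_nonneg ht.1, pow_succ, mul_assoc] using this

theorem hasDerivAt_pow_div_factorial (n : ℕ) (t : ℝ) :
    HasDerivAt (fun t : ℝ => t ^ (n + 1) / (n + 1).factorial) (t ^ n / n.factorial) t := by
  refine ((hasDerivAt_pow (n + 1) t).div_const _).congr_deriv ?_
  rw [Nat.factorial_succ]
  have := Nat.factorial_ne_zero n
  push_cast
  field_simp

/-- Two derivatives in the step `t` carry the remainder for `φ` to the remainder for `∂_i² φ` with
`k` lowered by one. The remainder and its first derivative vanish at `t = 0`, so the induction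
hypothesis is integrated twice and gains `t ^ 2`. No derivative beyond order `2 * k` is needed: the
induction starts from a bound on second differences. -/
theorem abs_secondDiff_sub_evenTaylor_le {Ω : Set Point} (hΩ : UniqueDiffOn ℝ Ω) (i : Fin 3)
    (q : Point) {h B : ℝ} (hB : 0 ≤ B) (hp : ∀ t ∈ Icc 0 h, q + Pi.single i t ∈ Ω)
    (hm : ∀ t ∈ Icc 0 h, q - Pi.single i t ∈ Ω) (k : ℕ) {φ : Point → ℝ}
    (hφ : ContDiffOn ℝ (2 * k : ℕ) φ Ω)
    (hb : ∀ t ∈ Icc 0 h, |secondDiff t i (purePartial Ω i (2 * k) φ) q| ≤ B) :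
    ∀ t ∈ Icc 0 h, |secondDiff t i φ q - evenTaylor Ω i k φ t q| ≤ B * t ^ (2 * k) := by
  induction k generalizing φ with
  | zero => intro t ht; simpa [evenTaylor] using! hb t ht
  | succ k ih =>
    have hφ' : ContDiffOn ℝ (2 * k + 1 + 1 : ℕ) φ Ω := hφ
    have h1 := contDiffOn_pderiv hΩ hφ' i
    have h2 := contDiffOn_pderiv hΩ h1 i
    have one_le : ∀ n : ℕ, ((1 : ℕ) : WithTop ℕ∞) ≤ ((n + 1 : ℕ) : WithTop ℕ∞) := by
      intro n; norm_cast; omega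
    have key := ih h2 hb
    -- The centre term `-2 ∂_i² φ q` of the second difference becomes the `j = 0` term of the twice
    -- differentiated Taylor sum.
    have hsum : ∀ t : ℝ, secondDiff t i (pderiv Ω i (pderiv Ω i φ)) q
          - evenTaylor Ω i k (pderiv Ω i (pderiv Ω i φ)) t q
        = pderiv Ω i (pderiv Ω i φ) (q - Pi.single i t)
          + pderiv Ω i (pderiv Ω i φ) (q + Pi.single i t)
          - ∑ j ∈ range (k + 1), 2 * (t ^ (2 * j) / (2 * j).factorial)
              * purePartial Ω i (2 * j + 2) φ q := by
      intro t
      have e0 : purePartial Ω i 2 φ q = pderiv Ω i (pderiv Ω i φ) q := rfl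
      simp only [secondDiff, evenTaylor, Finset.sum_range_succ', mul_zero, pow_zero,
        Nat.factorial_zero, zero_add, e0, Nat.cast_one, div_one, mul_add, mul_one]
      have e1 : ∀ j, purePartial Ω i (2 * j + 2 + 2) φ q
        = purePartial Ω i (2 * j + 2) (pderiv Ω i (pderiv Ω i φ)) q := fun j => rfl
      simp only [e1]
      ring
    have d1 : ∀ t ∈ Icc 0 h, |(pderiv Ω i φ (q + Pi.single i t) - pderiv Ω i φ (q - Pi.single i t))
        - ∑ j ∈ range (k + 1), 2 * (t ^ (2 * j + 1) / (2 * j + 1).factorial)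
              * purePartial Ω i (2 * j + 2) φ q| ≤ B * t ^ (2 * k + 1) := by
      intro t ht
      refine abs_le_mul_pow_succ_of_deriv (R := fun t =>
        (pderiv Ω i φ (q + Pi.single i t) - pderiv Ω i φ (q - Pi.single i t))
        - ∑ j ∈ range (k + 1), 2 * (t ^ (2 * j + 1) / (2 * j + 1).factorial)
              * purePartial Ω i (2 * j + 2) φ q) hB (fun t ht => ?_) (by simp) key ht
      rw [hsum]
      have a1 := (hasDerivWithinAt_line (h1.of_le (one_le _)) i q hp ht).sub
        (hasDerivWithinAt_line_neg (h1.of_le (one_le _)) i q hm ht)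
      have a2 := HasDerivWithinAt.fun_sum (u := range (k + 1)) (fun j _ =>
        (((hasDerivAt_pow_div_factorial (2 * j) t).const_mul 2).mul_const
          (purePartial Ω i (2 * j + 2) φ q)).hasDerivWithinAt (s := Icc 0 h))
      exact (a1.sub a2).congr_deriv (by ring)
    intro t ht
    refine abs_le_mul_pow_succ_of_deriv (R := fun t =>
      secondDiff t i φ q - evenTaylor Ω i (k + 1) φ t q) hB (fun t ht => ?_)
      (by simp [secondDiff, evenTaylor]; ring) d1 ht
    have a1 := ((hasDerivWithinAt_line_neg (hφ'.of_le (one_le _)) i q hm ht).sub_const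
      (2 * φ q)).add (hasDerivWithinAt_line (hφ'.of_le (one_le _)) i q hp ht)
    have a2 := HasDerivWithinAt.fun_sum (u := range (k + 1)) (fun j _ =>
      (((hasDerivAt_pow_div_factorial (2 * j + 1) t).const_mul 2).mul_const
        (purePartial Ω i (2 * j + 2) φ q)).hasDerivWithinAt (s := Icc 0 h))
    exact (a1.sub a2).congr_deriv (by ring)

/-! ### Gauges for second differences -/

/-- A monotone function on `[0, ∞)` that dominates the square. -/
structure IsGauge (ω : ℝ → ℝ) : Prop where
  mono : MonotoneOn ω (Ici 0)
  sq_le : ∀ h, 0 ≤ h → h ^ 2 ≤ ω h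

theorem IsGauge.nonneg {ω : ℝ → ℝ} (hω : IsGauge ω) {h : ℝ} (hh : 0 ≤ h) : 0 ≤ ω h :=
  (sq_nonneg h).trans (hω.sq_le h hh)

theorem isGauge_sq : IsGauge (fun h => h ^ 2) :=
  ⟨fun _ ha _ _ hab => pow_le_pow_left₀ ha hab 2, fun _ _ => le_rfl⟩

/-- The second differences of `φ` within `Ω` are `O(ω)`. -/
def SecondDiffBound (Ω : Set Point) (ω : ℝ → ℝ) (φ : Point → ℝ) : Prop :=
  ∃ C, 0 ≤ C ∧ ∀ (i : Fin 3) (h : ℝ) (q : Point), 0 ≤ h → q ∈ Ω → q - Pi.single i h ∈ Ω →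
    q + Pi.single i h ∈ Ω → |secondDiff h i φ q| ≤ C * ω h

/-- `φ` is of class `C^n` on `Ω`, and the second differences of its partial derivatives of order
`n` are `O(ω)`. -/
def HasGauge (Ω : Set Point) (ω : ℝ → ℝ) : ℕ → (Point → ℝ) → Prop
  | 0, φ => ContDiffOn ℝ (0 : ℕ) φ Ω ∧ SecondDiffBound Ω ω φ
  | n + 1, φ => ContDiffOn ℝ (n + 1 : ℕ) φ Ω ∧ ∀ i, HasGauge Ω ω n (pderiv Ω i φ)

theorem HasGauge.contDiffOn {Ω : Set Point} {ω : ℝ → ℝ} {n : ℕ} {φ : Point → ℝ}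
    (h : HasGauge Ω ω n φ) : ContDiffOn ℝ n φ Ω := by
  cases n with
  | zero => exact h.1
  | succ n => exact h.1

theorem HasGauge.purePartial {Ω : Set Point} {ω : ℝ → ℝ} {n k : ℕ} {φ : Point → ℝ}
    (h : HasGauge Ω ω (n + k) φ) (i : Fin 3) : HasGauge Ω ω n (purePartial Ω i k φ) := by
  induction k generalizing φ with
  | zero => exact h
  | succ k ih => exact ih (h.2 i)

theorem HasGauge.mono {Ω : Set Point} {ω ω' : ℝ → ℝ} (hle : ∀ h, 0 ≤ h → ω h ≤ ω' h) {n : ℕ}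
    {φ : Point → ℝ} (h : HasGauge Ω ω n φ) : HasGauge Ω ω' n φ := by
  induction n generalizing φ with
  | zero =>
    obtain ⟨C, hC, hb⟩ := h.2
    exact ⟨h.1, C, hC, fun i t q ht h1 h2 h3 => (hb i t q ht h1 h2 h3).trans
      (mul_le_mul_of_nonneg_left (hle t ht) hC)⟩
  | succ n ih => exact ⟨h.1, fun i => ih (h.2 i)⟩

theorem HasGauge.congr {Ω : Set Point} {ω : ℝ → ℝ} {n : ℕ} {φ ψ : Point → ℝ}
    (h : HasGauge Ω ω n φ) (he : EqOn φ ψ Ω) : HasGauge Ω ω n ψ := by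
  induction n generalizing φ ψ with
  | zero =>
    obtain ⟨C, hC, hb⟩ := h.2
    refine ⟨h.1.congr fun x hx => (he hx).symm, C, hC, fun i t q ht h1 h2 h3 => ?_⟩
    have := hb i t q ht h1 h2 h3
    simpa only [secondDiff, he h1, he h2, he h3] using this
  | succ n ih =>
    exact ⟨h.1.congr fun x hx => (he hx).symm, fun i => ih (h.2 i) (pderiv_congr he i)⟩

theorem one_le_succ_smoothness (n : ℕ) : ((1 : ℕ) : WithTop ℕ∞) ≤ ((n + 1 : ℕ) : WithTop ℕ∞) := by
  norm_cast; omega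

theorem HasGauge.add {Ω : Set Point} (hΩ : UniqueDiffOn ℝ Ω) {ω : ℝ → ℝ} {n : ℕ}
    {φ ψ : Point → ℝ} (h : HasGauge Ω ω n φ) (h' : HasGauge Ω ω n ψ) :
    HasGauge Ω ω n (fun p => φ p + ψ p) := by
  induction n generalizing φ ψ with
  | zero =>
    obtain ⟨C, hC, hb⟩ := h.2
    obtain ⟨C', hC', hb'⟩ := h'.2
    refine ⟨h.1.add h'.1, C + C', by positivity, fun i t q ht h1 h2 h3 => ?_⟩
    have e : secondDiff t i (fun p => φ p + ψ p) q = secondDiff t i φ q + secondDiff t i ψ q := by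
      simp only [secondDiff]; ring
    rw [e, add_mul]
    exact (abs_add_le _ _).trans (add_le_add (hb i t q ht h1 h2 h3) (hb' i t q ht h1 h2 h3))
  | succ n ih =>
    refine ⟨h.1.add h'.1, fun i => (ih (h.2 i) (h'.2 i)).congr ?_⟩
    exact (pderiv_add hΩ (h.1.of_le (one_le_succ_smoothness n))
      (h'.1.of_le (one_le_succ_smoothness n)) i).symm

theorem HasGauge.const_mul {Ω : Set Point} (hΩ : UniqueDiffOn ℝ Ω) {ω : ℝ → ℝ} {n : ℕ}
    {φ : Point → ℝ} (h : HasGauge Ω ω n φ) (c : ℝ) :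
    HasGauge Ω ω n (fun p => c * φ p) := by
  induction n generalizing φ with
  | zero =>
    obtain ⟨C, hC, hb⟩ := h.2
    refine ⟨contDiffOn_const.mul h.1, |c| * C, by positivity, fun i t q ht h1 h2 h3 => ?_⟩
    have e : secondDiff t i (fun p => c * φ p) q = c * secondDiff t i φ q := by
      simp only [secondDiff]; ring
    rw [e, abs_mul, mul_assoc]
    exact mul_le_mul_of_nonneg_left (hb i t q ht h1 h2 h3) (abs_nonneg c)
  | succ n ih =>
    refine ⟨contDiffOn_const.mul h.1, fun i => (ih (h.2 i)).congr ?_⟩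
    exact (pderiv_const_mul hΩ (h.1.of_le (one_le_succ_smoothness n)) c i).symm

theorem segment_add_mem {Ω : Set Point} (hc : Convex ℝ Ω) {q : Point} {i : Fin 3} {h : ℝ}
    (hq : q ∈ Ω) (hp : q + Pi.single i h ∈ Ω) {t : ℝ} (ht : t ∈ Icc 0 h) :
    q + Pi.single i t ∈ Ω := by
  rcases eq_or_lt_of_le (ht.1.trans ht.2) with h0 | h0
  · have : t = h := le_antisymm ht.2 (h0 ▸ ht.1)
    rwa [this]
  · have := hc.add_smul_mem hq hp (t := t / h)
      ⟨div_nonneg ht.1 h0.le, div_le_one_of_le₀ ht.2 h0.le⟩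
    rwa [← Pi.single_smul, smul_eq_mul, div_mul_cancel₀ _ h0.ne'] at this

theorem segment_sub_mem {Ω : Set Point} (hc : Convex ℝ Ω) {q : Point} {i : Fin 3} {h : ℝ}
    (hq : q ∈ Ω) (hp : q - Pi.single i h ∈ Ω) {t : ℝ} (ht : t ∈ Icc 0 h) :
    q - Pi.single i t ∈ Ω := by
  rcases eq_or_lt_of_le (ht.1.trans ht.2) with h0 | h0
  · have : t = h := le_antisymm ht.2 (h0 ▸ ht.1)
    rwa [this]
  · have := hc.add_smul_mem hq (y := -Pi.single i h) (by rwa [← sub_eq_add_neg]) (t := t / h)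
      ⟨div_nonneg ht.1 h0.le, div_le_one_of_le₀ ht.2 h0.le⟩
    rwa [smul_neg, ← Pi.single_smul, smul_eq_mul, div_mul_cancel₀ _ h0.ne',
      ← sub_eq_add_neg] at this

/-- The preceding Taylor estimate applies with `B = C * ω h`: by monotonicity of the gauge this
bounds the second differences for all steps `t ≤ h`, and by convexity the segments stay in `Ω`. -/
theorem HasGauge.exists_secondDiff_bound {Ω : Set Point} (hΩ : UniqueDiffOn ℝ Ω)
    (hc : Convex ℝ Ω) {ω : ℝ → ℝ} (hω : IsGauge ω) {k : ℕ} {φ : Point → ℝ}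
    (hφ : HasGauge Ω ω (2 * k) φ) (i : Fin 3) :
    ∃ C, 0 ≤ C ∧ ∀ (h : ℝ) (q : Point), 0 ≤ h → q ∈ Ω → q - Pi.single i h ∈ Ω →
      q + Pi.single i h ∈ Ω →
      |secondDiff h i φ q - evenTaylor Ω i k φ h q| ≤ C * (ω h * h ^ (2 * k)) := by
  have h0 : HasGauge Ω ω 0 (Helmholtz3D.purePartial Ω i (2 * k) φ) :=
    HasGauge.purePartial (by rwa [zero_add]) i
  obtain ⟨C, hC, hb⟩ := h0.2
  refine ⟨C, hC, fun h q hh hq hm hp => ?_⟩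
  rw [← mul_assoc]
  refine abs_secondDiff_sub_evenTaylor_le hΩ i q (mul_nonneg hC (hω.nonneg hh))
    (fun t ht => segment_add_mem hc hq hp ht) (fun t ht => segment_sub_mem hc hq hm ht) k
    hφ.contDiffOn (fun t ht => ?_) h ⟨hh, le_rfl⟩
  exact (hb i t q ht.1 hq (segment_sub_mem hc hq hm ht) (segment_add_mem hc hq hp ht)).trans
    (mul_le_mul_of_nonneg_left (hω.mono ht.1 hh ht.2) hC)

theorem hasGauge_sq {Ω : Set Point} (hΩ : UniqueDiffOn ℝ Ω) (hc : Convex ℝ Ω)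
    (hK : IsCompact Ω) {n : ℕ} {φ : Point → ℝ} (hφ : ContDiffOn ℝ (n + 2 : ℕ) φ Ω) :
    HasGauge Ω (fun h => h ^ 2) n φ := by
  induction n generalizing φ with
  | zero =>
    have hM : ∀ i, ∃ M, ∀ p ∈ Ω, ‖purePartial Ω i 2 φ p‖ ≤ M := fun i =>
      hK.exists_bound_of_continuousOn (contDiffOn_purePartial (n := 0) (k := 2) hΩ hφ i).continuousOn
    choose M hM using hM
    -- The Taylor term `h ^ 2 * ∂_i² φ` contributes `|M i|` and the remainder `4 * |M i|`; summing
    -- over `i` gives one constant for all directions.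
    refine ⟨hφ.of_le (by simp), ∑ i, 5 * |M i|, by positivity, fun i h q hh hq hm hp => ?_⟩
    have hM' : ∀ p ∈ Ω, |purePartial Ω i 2 φ p| ≤ |M i| := fun p hp =>
      (hM i p hp).trans (le_abs_self _)
    have key := abs_secondDiff_sub_evenTaylor_le hΩ i q (B := 4 * |M i|) (by positivity)
      (fun t ht => segment_add_mem hc hq hp ht) (fun t ht => segment_sub_mem hc hq hm ht) 1
      hφ (fun t ht => by
        have a1 := hM' _ (segment_add_mem hc hq hp ht)
        have a2 := hM' _ (segment_sub_mem hc hq hm ht)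
        have a3 := hM' _ hq
        simp only [secondDiff, mul_one]
        rw [abs_le] at *
        constructor <;> linarith) h ⟨hh, le_rfl⟩
    have hle : 5 * |M i| ≤ ∑ i, 5 * |M i| :=
      Finset.single_le_sum (f := fun i => 5 * |M i|) (fun i _ => by positivity)
        (Finset.mem_univ i)
    refine le_trans ?_ (mul_le_mul_of_nonneg_right hle (sq_nonneg h))
    have e : evenTaylor Ω i 1 φ h q = h ^ 2 * purePartial Ω i 2 φ q := by
      simp [evenTaylor, mul_div_cancel₀]
    rw [e, mul_one] at key
    have h2 : |h ^ 2 * purePartial Ω i 2 φ q| ≤ h ^ 2 * |M i| := by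
      rw [abs_mul, abs_of_nonneg (sq_nonneg h)]
      exact mul_le_mul_of_nonneg_left (hM' q hq) (sq_nonneg h)
    change |secondDiff h i φ q| ≤ 5 * |M i| * h ^ 2
    rw [abs_le] at *
    constructor <;> linarith
  | succ n ih =>
    refine ⟨hφ.of_le (by norm_cast; omega), fun i => ih (contDiffOn_pderiv hΩ ?_ i)⟩
    exact hφ

/-! ### The modulus of continuity is a gauge -/

/-- The modulus of continuity of `φ` on `Ω`. -/
def modulus (Ω : Set Point) (φ : Point → ℝ) (h : ℝ) : ℝ :=
  sSup (insert 0 {r | ∃ p ∈ Ω, ∃ q ∈ Ω, dist p q ≤ h ∧ r = |φ p - φ q|})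

theorem exists_gauge_of_continuousOn {Ω : Set Point} (hK : IsCompact Ω) {φ : Point → ℝ}
    (hφ : ContDiffOn ℝ (0 : ℕ) φ Ω) :
    ∃ ω, IsGauge ω ∧ Tendsto ω (𝓝[>] 0) (𝓝 0) ∧ HasGauge Ω ω 0 φ := by
  obtain ⟨M, hM⟩ := hK.exists_bound_of_continuousOn hφ.continuousOn
  have hbdd : ∀ h, BddAbove
      (insert 0 {r | ∃ p ∈ Ω, ∃ q ∈ Ω, dist p q ≤ h ∧ r = |φ p - φ q|}) := by
    intro h
    refine ⟨2 * |M|, ?_⟩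
    rintro r (rfl | ⟨p, hp, q, hq, -, rfl⟩)
    · positivity
    · have h1 := (hM p hp).trans (le_abs_self M)
      have h2 := (hM q hq).trans (le_abs_self M)
      rw [Real.norm_eq_abs, abs_le] at h1 h2
      rw [abs_le]
      constructor <;> linarith
  have hnn : ∀ h, 0 ≤ modulus Ω φ h := fun h => le_csSup (hbdd h) (mem_insert _ _)
  have hmono : ∀ s t, s ≤ t → modulus Ω φ s ≤ modulus Ω φ t := by
    intro s t hst
    refine csSup_le_csSup (hbdd t) (insert_nonempty _ _) (insert_subset_insert ?_)
    rintro r ⟨p, hp, q, hq, hd, rfl⟩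
    exact ⟨p, hp, q, hq, hd.trans hst, rfl⟩
  -- The summand `h ^ 2` makes the modulus a gauge. The constant `2` counts the two first
  -- differences that make up a second difference.
  refine ⟨fun h => h ^ 2 + modulus Ω φ h, ⟨fun s hs t ht hst => ?_, fun h _ => ?_⟩, ?_,
    hφ, 2, by norm_num, fun i h q hh hq hm hp => ?_⟩
  · exact add_le_add (pow_le_pow_left₀ hs hst 2) (hmono s t hst)
  · exact le_add_of_nonneg_right (hnn h)
  · have h1 : Tendsto (fun h : ℝ => h ^ 2) (𝓝[>] 0) (𝓝 0) := by
      have : Tendsto (fun h : ℝ => h ^ 2) (𝓝 0) (𝓝 (0 ^ 2)) := (continuous_pow 2).tendsto 0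
      rw [zero_pow two_ne_zero] at this
      exact this.mono_left nhdsWithin_le_nhds
    have h2 : Tendsto (modulus Ω φ) (𝓝[>] 0) (𝓝 0) := by
      rw [Metric.tendsto_nhdsWithin_nhds]
      intro ε hε
      have huc := hK.uniformContinuousOn_of_continuous hφ.continuousOn
      rw [Metric.uniformContinuousOn_iff] at huc
      obtain ⟨δ, hδ, huc⟩ := huc (ε / 2) (by positivity)
      refine ⟨δ, hδ, fun h hh hd => ?_⟩
      rw [Real.dist_eq, sub_zero] at hd ⊢
      rw [abs_of_nonneg (hnn h)]
      refine lt_of_le_of_lt (csSup_le (insert_nonempty _ _) ?_) (half_lt_self hε)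
      rintro r (rfl | ⟨p, hp, q, hq, hpq, rfl⟩)
      · positivity
      · exact (huc p hp q hq (hpq.trans_lt ((le_abs_self h).trans_lt hd))).le
    simpa using h1.add h2
  · have dist_le : ∀ p ∈ Ω, dist p q ≤ h → |φ p - φ q| ≤ modulus Ω φ h := fun p hp hd =>
      le_csSup (hbdd h) (mem_insert_of_mem _ ⟨p, hp, q, hq, hd, rfl⟩)
    have d0 : ‖(Pi.single i h : Point)‖ ≤ h := by
      rw [Pi.norm_single, Real.norm_eq_abs, abs_of_nonneg hh]
    have d1 := dist_le _ hm (by rwa [dist_eq_norm, sub_sub_cancel_left, norm_neg])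
    have d2 := dist_le _ hp (by rwa [dist_eq_norm, add_sub_cancel_left])
    have := sq_nonneg h
    simp only [secondDiff]
    rw [abs_le] at *
    constructor <;> linarith

theorem exists_gauge {Ω : Set Point} (hΩ : UniqueDiffOn ℝ Ω) (hK : IsCompact Ω) {n : ℕ}
    {φ : Point → ℝ} (hφ : ContDiffOn ℝ n φ Ω) :
    ∃ ω, IsGauge ω ∧ Tendsto ω (𝓝[>] 0) (𝓝 0) ∧ HasGauge Ω ω n φ := by
  induction n generalizing φ with
  | zero => exact exists_gauge_of_continuousOn hK hφ
  | succ n ih =>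
    choose ω hω hlim hg using fun i => ih (contDiffOn_pderiv hΩ hφ i)
    have hle : ∀ i h, 0 ≤ h → ω i h ≤ ∑ j, ω j h := fun i h hh =>
      Finset.single_le_sum (f := fun j => ω j h) (fun j _ => (hω j).nonneg hh) (Finset.mem_univ i)
    -- The sum of the gauges of the three first partials serves all of them at once and still tends
    -- to zero.
    refine ⟨fun h => ∑ i, ω i h, ⟨fun s hs t ht hst => ?_, fun h hh => ?_⟩, ?_, hφ, fun i => ?_⟩
    · exact Finset.sum_le_sum fun i _ => (hω i).mono hs ht hst
    · exact ((hω 0).sq_le h hh).trans (hle 0 h hh)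
    · simpa using tendsto_finsetSum Finset.univ fun i _ => hlim i
    · exact (hg i).mono (hle i)

/-! ### Compositions of second differences -/

/-- Composition of undivided second differences, the head of the list being applied first. -/
def iterDiff (h : ℝ) : List (Fin 3) → (Point → ℝ) → Point → ℝ
  | [], φ => φ
  | i :: is, φ => iterDiff h is (secondDiff h i φ)

/-- The points at which `iterDiff h is` only uses values at points of `Ω`. -/
def iterDomain (h : ℝ) : List (Fin 3) → Set Point → Set Point
  | [], Ω => Ω
  | i :: is, Ω => iterDomain h is {q | q ∈ Ω ∧ q - Pi.single i h ∈ Ω ∧ q + Pi.single i h ∈ Ω}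

/-- The Taylor polynomial of `iterDiff h is φ p` of order `2N` in `h`. -/
def iterTaylor (Ω : Set Point) : List (Fin 3) → ℕ → (Point → ℝ) → ℝ → Point → ℝ
  | [], _, φ, _, p => φ p
  | i :: is, N, φ, h, p => ∑ j ∈ range N, 2 * (h ^ (2 * j + 2) / (2 * j + 2).factorial) *
      iterTaylor Ω is (N - 1 - j) (purePartial Ω i (2 * j + 2) φ) h p

theorem iterDomain_mono (h : ℝ) (is : List (Fin 3)) {Ω Ω' : Set Point} (hs : Ω ⊆ Ω') :
    iterDomain h is Ω ⊆ iterDomain h is Ω' := by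
  induction is generalizing Ω Ω' with
  | nil => exact hs
  | cons i is ih => exact ih fun q hq => ⟨hs hq.1, hs hq.2.1, hs hq.2.2⟩

/-- The weights `1, -2, 1` have absolute sum 4, whence one factor 4 per difference. -/
theorem abs_iterDiff_le {h B : ℝ} {is : List (Fin 3)} {Ω : Set Point} {φ : Point → ℝ}
    (hφ : ∀ q ∈ Ω, |φ q| ≤ B) {p : Point} (hp : p ∈ iterDomain h is Ω) :
    |iterDiff h is φ p| ≤ 4 ^ is.length * B := by
  induction is generalizing φ Ω B with
  | nil => simpa using! hφ p hp
  | cons i is ih =>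
    have := ih (B := 4 * B) (φ := secondDiff h i φ) (fun q hq => ?_) hp
    · rw [List.length_cons, pow_succ, mul_assoc]
      exact this
    · have h1 := hφ _ hq.1
      have h2 := hφ _ hq.2.1
      have h3 := hφ _ hq.2.2
      simp only [secondDiff]
      rw [abs_le] at *
      constructor <;> linarith

theorem iterDiff_sub_sum (h : ℝ) (is : List (Fin 3)) (φ : Point → ℝ) {ι : Type*} (s : Finset ι)
    (c : ι → ℝ) (ψ : ι → Point → ℝ) (p : Point) :
    iterDiff h is (fun q => φ q - ∑ j ∈ s, c j * ψ j q) p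
      = iterDiff h is φ p - ∑ j ∈ s, c j * iterDiff h is (ψ j) p := by
  induction is generalizing φ ψ with
  | nil => rfl
  | cons i is ih =>
    have e : secondDiff h i (fun q => φ q - ∑ j ∈ s, c j * ψ j q)
        = fun q => secondDiff h i φ q - ∑ j ∈ s, c j * secondDiff h i (ψ j) q := by
      funext q
      have : ∑ j ∈ s, c j * secondDiff h i (ψ j) q = ∑ j ∈ s, c j * ψ j (q - Pi.single i h)
          - 2 * ∑ j ∈ s, c j * ψ j q + ∑ j ∈ s, c j * ψ j (q + Pi.single i h) := by
        rw [Finset.mul_sum, ← Finset.sum_sub_distrib, ← Finset.sum_add_distrib]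
        exact Finset.sum_congr rfl fun j _ => by simp only [secondDiff]; ring
      rw [this]
      simp only [secondDiff]
      ring
    simp only [iterDiff, e, ih]

/-- The first difference is expanded by the one-dimensional estimate, and the remaining differences
act linearly on that expansion. Its remainder grows by at most `4 ^ is.length`. The term with
`∂_i^(2j+2) φ` has weight `h ^ (2j+2)` and loses `2j+2` orders of smoothness, so it is expanded
recursively only to order `2 * (N - 1 - j)`; the powers of `h` add up to `2 * N`. -/
theorem HasGauge.exists_iterDiff_bound {Ω : Set Point} (hΩ : UniqueDiffOn ℝ Ω)
    (hc : Convex ℝ Ω) {ω : ℝ → ℝ} (hω : IsGauge ω) (is : List (Fin 3)) {N : ℕ} {φ : Point → ℝ}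
    (hφ : HasGauge Ω ω (2 * N) φ) :
    ∃ C, 0 ≤ C ∧ ∀ (h : ℝ) (p : Point), 0 ≤ h → p ∈ iterDomain h is Ω →
      |iterDiff h is φ p - iterTaylor Ω is N φ h p| ≤ C * (ω h * h ^ (2 * N)) := by
  induction is generalizing φ N with
  | nil => exact ⟨0, le_rfl, fun h p _ _ => by simp [iterDiff, iterTaylor]⟩
  | cons i is ih =>
    obtain ⟨C₀, hC₀, hb₀⟩ := hφ.exists_secondDiff_bound hΩ hc hω i
    -- The condition `j < N` sits inside the existential so that `choose` yields a constant for
    -- every natural number `j`.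
    have hj : ∀ j, ∃ C, 0 ≤ C ∧ (j < N → ∀ (h : ℝ) (p : Point), 0 ≤ h → p ∈ iterDomain h is Ω →
        |iterDiff h is (Helmholtz3D.purePartial Ω i (2 * j + 2) φ) p
          - iterTaylor Ω is (N - 1 - j) (Helmholtz3D.purePartial Ω i (2 * j + 2) φ) h p|
          ≤ C * (ω h * h ^ (2 * (N - 1 - j)))) := by
      intro j
      by_cases hjN : j < N
      · obtain ⟨C, hC, hb⟩ := ih (N := N - 1 - j)
          (φ := Helmholtz3D.purePartial Ω i (2 * j + 2) φ) (HasGauge.purePartial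
            (by rwa [show 2 * (N - 1 - j) + (2 * j + 2) = 2 * N by omega]) i)
        exact ⟨C, hC, fun _ => hb⟩
      · exact ⟨0, le_rfl, fun h => absurd h hjN⟩
    choose C hC hb using hj
    refine ⟨4 ^ is.length * C₀ + ∑ j ∈ range N, 2 * C j,
      add_nonneg (by positivity) (Finset.sum_nonneg fun j _ => by linarith [hC j]),
      fun h p hh hp => ?_⟩
    have hp' : p ∈ iterDomain h is Ω := iterDomain_mono h is (fun q hq => hq.1) hp
    have h1 := abs_iterDiff_le (is := is)
      (Ω := {q | q ∈ Ω ∧ q - Pi.single i h ∈ Ω ∧ q + Pi.single i h ∈ Ω}) (B := C₀ * (ω h * h ^ (2 * N)))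
      (φ := fun q => secondDiff h i φ q - evenTaylor Ω i N φ h q)
      (fun q hq => hb₀ h q hh hq.1 hq.2.1 hq.2.2) hp
    simp only [evenTaylor, iterDiff_sub_sum] at h1
    have e : iterDiff h (i :: is) φ p - iterTaylor Ω (i :: is) N φ h p
        = (iterDiff h is (secondDiff h i φ) p - ∑ j ∈ range N,
            2 * (h ^ (2 * j + 2) / (2 * j + 2).factorial)
              * iterDiff h is (Helmholtz3D.purePartial Ω i (2 * j + 2) φ) p)
          + ∑ j ∈ range N, 2 * (h ^ (2 * j + 2) / (2 * j + 2).factorial) *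
            (iterDiff h is (Helmholtz3D.purePartial Ω i (2 * j + 2) φ) p
              - iterTaylor Ω is (N - 1 - j) (Helmholtz3D.purePartial Ω i (2 * j + 2) φ) h p) := by
      simp only [iterDiff, iterTaylor, mul_sub, Finset.sum_sub_distrib]
      ring
    rw [e, add_mul, mul_assoc]
    refine (abs_add_le _ _).trans (add_le_add h1 ?_)
    rw [Finset.sum_mul]
    refine (Finset.abs_sum_le_sum_abs _ _).trans (Finset.sum_le_sum fun j hjm => ?_)
    have hjN := Finset.mem_range.1 hjm
    have hfac : h ^ (2 * j + 2) / ((2 * j + 2).factorial : ℝ) ≤ h ^ (2 * j + 2) :=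
      div_le_self (by positivity) (by exact_mod_cast Nat.factorial_pos _)
    rw [abs_mul, abs_of_nonneg (by positivity)]
    calc _ ≤ 2 * h ^ (2 * j + 2) * (C j * (ω h * h ^ (2 * (N - 1 - j)))) :=
          mul_le_mul (mul_le_mul_of_nonneg_left hfac zero_le_two) (hb j hjN h p hh hp')
            (abs_nonneg _) (by positivity)
      _ = 2 * C j * (ω h * (h ^ (2 * (N - 1 - j)) * h ^ (2 * j + 2))) := by ring
      _ = _ := by rw [← pow_add, show 2 * (N - 1 - j) + (2 * j + 2) = 2 * N by omega]

/-! ### Derivatives of the source term -/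

theorem mixedPartial_congr {Ω : Set Point} {φ ψ : Point → ℝ} (h : EqOn φ ψ Ω) (r s t : ℕ) :
    EqOn (mixedPartial Ω r s t φ) (mixedPartial Ω r s t ψ) Ω :=
  purePartial_congr (purePartial_congr (purePartial_congr h 2 t) 1 s) 0 r

theorem contDiffOn_mixedPartial {Ω : Set Point} (hΩ : UniqueDiffOn ℝ Ω) {n r s t : ℕ}
    {φ : Point → ℝ} (h : ContDiffOn ℝ (n + r + s + t : ℕ) φ Ω) :
    ContDiffOn ℝ n (mixedPartial Ω r s t φ) Ω :=
  contDiffOn_purePartial hΩ (contDiffOn_purePartial hΩ (contDiffOn_purePartial hΩ h 2) 1) 0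

theorem mixedPartial_add {Ω : Set Point} (hΩ : UniqueDiffOn ℝ Ω) {r s t : ℕ} {φ ψ : Point → ℝ}
    (hφ : ContDiffOn ℝ (r + s + t : ℕ) φ Ω) (hψ : ContDiffOn ℝ (r + s + t : ℕ) ψ Ω) :
    EqOn (mixedPartial Ω r s t (fun p => φ p + ψ p))
      (fun p => mixedPartial Ω r s t φ p + mixedPartial Ω r s t ψ p) Ω := by
  have ht : ((t : ℕ) : WithTop ℕ∞) ≤ ((r + s + t : ℕ) : WithTop ℕ∞) := by norm_cast; omega
  have hs : ((s : ℕ) : WithTop ℕ∞) ≤ ((r + s : ℕ) : WithTop ℕ∞) := by norm_cast; omega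
  have hφ1 := contDiffOn_purePartial hΩ hφ 2
  have hψ1 := contDiffOn_purePartial hΩ hψ 2
  have hφ2 := contDiffOn_purePartial hΩ hφ1 1
  have hψ2 := contDiffOn_purePartial hΩ hψ1 1
  have e1 := purePartial_add hΩ (hφ.of_le ht) (hψ.of_le ht) 2
  have e2 := purePartial_add hΩ (hφ1.of_le hs) (hψ1.of_le hs) 1
  have e3 := purePartial_add hΩ hφ2 hψ2 0
  exact (purePartial_congr ((purePartial_congr e1 1 s).trans e2) 0 r).trans e3

theorem mixedPartial_const_mul {Ω : Set Point} (hΩ : UniqueDiffOn ℝ Ω) {r s t : ℕ}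
    {φ : Point → ℝ} (hφ : ContDiffOn ℝ (r + s + t : ℕ) φ Ω) (c : ℝ) :
    EqOn (mixedPartial Ω r s t (fun p => c * φ p)) (fun p => c * mixedPartial Ω r s t φ p) Ω := by
  have ht : ((t : ℕ) : WithTop ℕ∞) ≤ ((r + s + t : ℕ) : WithTop ℕ∞) := by norm_cast; omega
  have hs : ((s : ℕ) : WithTop ℕ∞) ≤ ((r + s : ℕ) : WithTop ℕ∞) := by norm_cast; omega
  have hφ1 := contDiffOn_purePartial hΩ hφ 2
  have hφ2 := contDiffOn_purePartial hΩ hφ1 1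
  have e1 := purePartial_const_mul hΩ (hφ.of_le ht) c 2
  have e2 := purePartial_const_mul hΩ (hφ1.of_le hs) c 1
  have e3 := purePartial_const_mul hΩ hφ2 c 0
  exact (purePartial_congr ((purePartial_congr e1 1 s).trans e2) 0 r).trans e3

theorem mixedPartial_purePartial_two {Ω : Set Point} (r s t : ℕ) (φ : Point → ℝ) (k : ℕ) :
    mixedPartial Ω r s t (purePartial Ω 2 k φ) = mixedPartial Ω r s (t + k) φ := by
  rw [mixedPartial, mixedPartial, purePartial_add_order]

theorem mixedPartial_purePartial_one {Ω : Set Point} (hΩ : UniqueDiffOn ℝ Ω)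
    (hcl : Ω ⊆ closure (interior Ω)) {r s t k : ℕ} {φ : Point → ℝ}
    (hφ : ContDiffOn ℝ (r + s + t + k : ℕ) φ Ω) :
    EqOn (mixedPartial Ω r s t (purePartial Ω 1 k φ)) (mixedPartial Ω r (s + k) t φ) Ω := by
  have hle : ((k + t : ℕ) : WithTop ℕ∞) ≤ ((r + s + t + k : ℕ) : WithTop ℕ∞) := by
    norm_cast; omega
  simp only [mixedPartial, purePartial_add_order Ω 1 s k]
  exact purePartial_congr (purePartial_congr (purePartial_comm hΩ hcl (hφ.of_le hle) 2 1) 1 s) 0 r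

theorem mixedPartial_purePartial_zero {Ω : Set Point} (hΩ : UniqueDiffOn ℝ Ω)
    (hcl : Ω ⊆ closure (interior Ω)) {r s t k : ℕ} {φ : Point → ℝ}
    (hφ : ContDiffOn ℝ (r + s + t + k : ℕ) φ Ω) :
    EqOn (mixedPartial Ω r s t (purePartial Ω 0 k φ)) (mixedPartial Ω (r + k) s t φ) Ω := by
  have hle : ((k + t : ℕ) : WithTop ℕ∞) ≤ ((r + s + t + k : ℕ) : WithTop ℕ∞) := by
    norm_cast; omega
  have hle' : ((k + s + t : ℕ) : WithTop ℕ∞) ≤ ((r + s + t + k : ℕ) : WithTop ℕ∞) := by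
    norm_cast; omega
  simp only [mixedPartial, purePartial_add_order Ω 0 r k]
  refine purePartial_congr ((purePartial_congr
    (purePartial_comm hΩ hcl (hφ.of_le hle) 2 0) 1 s).trans ?_) 0 r
  exact purePartial_comm hΩ hcl (contDiffOn_purePartial hΩ (hφ.of_le hle') 2) 1 0

theorem IsHelmholtzSolution.eqOn {Ω : Set Point} {K : ℝ} {u f : Point → ℝ}
    (h : IsHelmholtzSolution Ω K u f) :
    EqOn f (fun p => purePartial Ω 0 2 u p + (purePartial Ω 1 2 u p
      + (purePartial Ω 2 2 u p + K ^ 2 * u p))) Ω := by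
  intro p hp
  have := h p hp
  simp only [nabla, Fin.sum_univ_three] at this
  simp only [← this]
  ring

/-- The equation is differentiated as an identity on `Ω`, and the two extra derivatives are then
commuted into the fixed order of `mixedPartial`. -/
theorem IsHelmholtzSolution.mixedPartial_eq {Ω : Set Point} (hΩ : UniqueDiffOn ℝ Ω)
    (hcl : Ω ⊆ closure (interior Ω)) {K : ℝ} {u f : Point → ℝ}
    (h : IsHelmholtzSolution Ω K u f) {r s t : ℕ}
    (hu : ContDiffOn ℝ (r + s + t + 2 : ℕ) u Ω) {p : Point} (hp : p ∈ Ω) :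
    mixedPartial Ω r s t f p = mixedPartial Ω (r + 2) s t u p + mixedPartial Ω r (s + 2) t u p
      + mixedPartial Ω r s (t + 2) u p + K ^ 2 * mixedPartial Ω r s t u p := by
  have h0 : ContDiffOn ℝ (r + s + t : ℕ) u Ω := hu.of_le (by norm_cast; omega)
  have hi : ∀ i, ContDiffOn ℝ (r + s + t : ℕ) (purePartial Ω i 2 u) Ω :=
    contDiffOn_purePartial hΩ hu
  have hK : ContDiffOn ℝ (r + s + t : ℕ) (fun p => K ^ 2 * u p) Ω := contDiffOn_const.mul h0
  have e0 := mixedPartial_add hΩ (hi 0) ((hi 1).add ((hi 2).add hK)) hp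
  have e1 := mixedPartial_add hΩ (hi 1) ((hi 2).add hK) hp
  have e2 := mixedPartial_add hΩ (hi 2) hK hp
  have e3 := mixedPartial_const_mul hΩ h0 (K ^ 2) hp
  beta_reduce at e0 e1 e2 e3
  rw [mixedPartial_congr h.eqOn r s t hp, e0, e1, e2, e3, mixedPartial_purePartial_two,
    mixedPartial_purePartial_one hΩ hcl hu hp, mixedPartial_purePartial_zero hΩ hcl hu hp]
  ring

/-- Second partials of `u` inherit its gauge. The term `K ^ 2 * u` has two derivatives to spare,
hence gauge `h ^ 2`, which every gauge dominates. -/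
theorem IsHelmholtzSolution.hasGauge {Ω : Set Point} (hΩ : UniqueDiffOn ℝ Ω)
    (hc : Convex ℝ Ω) (hK : IsCompact Ω) {K : ℝ} {u f : Point → ℝ}
    (h : IsHelmholtzSolution Ω K u f) {ω : ℝ → ℝ} (hω : IsGauge ω) {n : ℕ}
    (hu : HasGauge Ω ω (n + 2) u) : HasGauge Ω ω n f := by
  have h0 : HasGauge Ω ω n u := (hasGauge_sq hΩ hc hK hu.contDiffOn).mono hω.sq_le
  exact ((hu.purePartial 0).add hΩ ((hu.purePartial 1).add hΩ ((hu.purePartial 2).add hΩ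
    (h0.const_mul hΩ (K ^ 2))))).congr h.eqOn.symm

/-! ### The scheme in terms of undivided differences -/

theorem mem_iterDomain_of_stencil27_subset {Ω : Set Point} {h : ℝ} {p : Point}
    (hst : stencil27 h p ⊆ Ω) :
    (∀ i, p ∈ iterDomain h [i] Ω) ∧ p ∈ iterDomain h [1, 0] Ω ∧ p ∈ iterDomain h [2, 1] Ω ∧
      p ∈ iterDomain h [2, 0] Ω ∧ p ∈ iterDomain h [2, 1, 0] Ω := by
  refine ⟨fun i => ?_, ?_, ?_, ?_, ?_⟩
  · simp only [iterDomain, mem_ofPred_eq]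
    and_intros <;> refine hst fun k => ?_ <;> by_cases hk : k = i <;> simp [hk]
  all_goals
    simp only [iterDomain, mem_ofPred_eq]
    and_intros <;> refine hst fun k => ?_ <;> fin_cases k <;> simp

theorem iterDiff_congr {h : ℝ} {is : List (Fin 3)} {Ω : Set Point} {φ ψ : Point → ℝ}
    (he : EqOn φ ψ Ω) {p : Point} (hp : p ∈ iterDomain h is Ω) :
    iterDiff h is φ p = iterDiff h is ψ p := by
  induction is generalizing φ ψ Ω with
  | nil => exact he hp
  | cons i is ih =>
    refine ih (φ := secondDiff h i φ) (ψ := secondDiff h i ψ) (fun q hq => ?_) hp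
    simp only [secondDiff, he hq.1, he hq.2.1, he hq.2.2]

theorem deltaSum_eq (h : ℝ) (φ : Point → ℝ) (p : Point) :
    deltaSum h φ p = (iterDiff h [0] φ p + iterDiff h [1] φ p + iterDiff h [2] φ p) / h ^ 2 := by
  simp only [deltaSum, delta2, iterDiff, secondDiff]
  ring

theorem deltaPairSum_eq (h : ℝ) (φ : Point → ℝ) (p : Point) :
    deltaPairSum h φ p
      = (iterDiff h [1, 0] φ p + iterDiff h [2, 1] φ p + iterDiff h [2, 0] φ p) / h ^ 4 := by
  simp only [deltaPairSum, delta2, iterDiff, secondDiff]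
  ring

theorem deltaTriple_eq (h : ℝ) (φ : Point → ℝ) (p : Point) :
    deltaTriple h φ p = iterDiff h [2, 1, 0] φ p / h ^ 6 := by
  simp only [deltaTriple, delta2, iterDiff, secondDiff]
  ring

theorem deltaPartialSum_eq (Ω : Set Point) (h : ℝ) (φ : Point → ℝ) (p : Point) :
    deltaPartialSum Ω h φ p = (iterDiff h [0] (purePartial Ω 0 2 φ) p
      + iterDiff h [1] (purePartial Ω 1 2 φ) p + iterDiff h [2] (purePartial Ω 2 2 φ) p)
        / h ^ 2 := by
  simp only [deltaPartialSum, Fin.sum_univ_three, delta2, iterDiff, secondDiff]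
  ring

theorem schemeLHS_congr {K h : ℝ} {p : Point} {φ ψ : Point → ℝ}
    (he : EqOn φ ψ (stencil27 h p)) : schemeLHS K h φ p = schemeLHS K h ψ p := by
  obtain ⟨m1, m10, m21, m20, m210⟩ := mem_iterDomain_of_stencil27_subset (subset_refl (stencil27 h p))
  simp only [schemeLHS, deltaSum_eq, deltaPairSum_eq, deltaTriple_eq, iterDiff_congr he (m1 _),
    iterDiff_congr he m10, iterDiff_congr he m21, iterDiff_congr he m20, iterDiff_congr he m210,
    he (m1 0).1]

theorem schemeRHS_congr {Ω : Set Point} {K h : ℝ} {p : Point} {φ ψ : Point → ℝ}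
    (he : EqOn φ ψ (stencil27 h p))
    (he' : ∀ i, EqOn (purePartial Ω i 2 φ) (purePartial Ω i 2 ψ) (stencil27 h p)) :
    schemeRHS Ω K h φ p = schemeRHS Ω K h ψ p := by
  obtain ⟨m1, m10, m21, m20, -⟩ := mem_iterDomain_of_stencil27_subset (subset_refl (stencil27 h p))
  simp only [schemeRHS, nabla, deltaSum_eq, deltaPairSum_eq, deltaPartialSum_eq,
    iterDiff_congr he (m1 _), iterDiff_congr (he' _) (m1 _), iterDiff_congr he m10,
    iterDiff_congr he m21, iterDiff_congr he m20, he (m1 0).1, he' _ (m1 0).1]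

/-- The factors `h ^ 2` in `C2` and `h ^ 4` in `C3` cancel the denominators of the composed
differences, so one factor `h ^ 2` clears all of them. -/
theorem sq_mul_schemeLHS {K h : ℝ} (hh : h ≠ 0) (u : Point → ℝ) (p : Point) :
    h ^ 2 * schemeLHS K h u p
      = C1 K h * (iterDiff h [0] u p + iterDiff h [1] u p + iterDiff h [2] u p)
        + (1 + K ^ 2 * h ^ 2 / 30 + K ^ 4 * h ^ 4 / 840) / 6
          * (iterDiff h [1, 0] u p + iterDiff h [2, 1] u p + iterDiff h [2, 0] u p)
        + (1 + 17 * K ^ 2 * h ^ 2 / 252) / 30 * iterDiff h [2, 1, 0] u p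
        + C4 K h * h ^ 2 * u p := by
  rw [schemeLHS, deltaSum_eq, deltaPairSum_eq, deltaTriple_eq, C2, C3]
  field_simp

theorem sq_mul_schemeRHS {Ω : Set Point} {K h : ℝ} (hh : h ≠ 0) (f : Point → ℝ) (p : Point) :
    h ^ 2 * schemeRHS Ω K h f p
      = D1 K h * h ^ 2 * f p
        + K ^ 4 * h ^ 4 / 20160 * h ^ 2
          * (iterDiff h [0] f p + iterDiff h [1] f p + iterDiff h [2] f p)
        + (1 + K ^ 2 * h ^ 2 / 112) / 90 * h ^ 2
          * (iterDiff h [1, 0] f p + iterDiff h [2, 1] f p + iterDiff h [2, 0] f p)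
        + D4 K h * h ^ 2 * nabla Ω 2 f p
        + (1 - K ^ 2 * h ^ 2 / 56) / 360 * h ^ 4
          * (iterDiff h [0] (purePartial Ω 0 2 f) p + iterDiff h [1] (purePartial Ω 1 2 f) p
            + iterDiff h [2] (purePartial Ω 2 2 f) p) := by
  rw [schemeRHS, deltaSum_eq, deltaPairSum_eq, deltaPartialSum_eq, D2, D3, D5]
  field_simp

/-! ### Explicit Taylor polynomials -/

/-- The coefficients `1, 1/12, 1/360, 1/20160` here and below are `2 / (2j+2)!`; composed
differences multiply them, as in `1/144`. -/
theorem iterTaylor_one_two (Ω : Set Point) (i : Fin 3) (φ : Point → ℝ) (h : ℝ) (p : Point) :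
    iterTaylor Ω [i] 2 φ h p
      = h ^ 2 * purePartial Ω i 2 φ p + h ^ 4 / 12 * purePartial Ω i 4 φ p := by
  simp only [iterTaylor, Finset.sum_range_succ, Finset.range_zero, Finset.sum_empty]
  norm_num [Nat.factorial]
  ring

theorem iterTaylor_one_three (Ω : Set Point) (i : Fin 3) (φ : Point → ℝ) (h : ℝ) (p : Point) :
    iterTaylor Ω [i] 3 φ h p
      = h ^ 2 * purePartial Ω i 2 φ p + h ^ 4 / 12 * purePartial Ω i 4 φ p
        + h ^ 6 / 360 * purePartial Ω i 6 φ p := by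
  simp only [iterTaylor, Finset.sum_range_succ, Finset.range_zero, Finset.sum_empty]
  norm_num [Nat.factorial]
  ring

theorem iterTaylor_one_four (Ω : Set Point) (i : Fin 3) (φ : Point → ℝ) (h : ℝ) (p : Point) :
    iterTaylor Ω [i] 4 φ h p
      = h ^ 2 * purePartial Ω i 2 φ p + h ^ 4 / 12 * purePartial Ω i 4 φ p
        + h ^ 6 / 360 * purePartial Ω i 6 φ p + h ^ 8 / 20160 * purePartial Ω i 8 φ p := by
  simp only [iterTaylor, Finset.sum_range_succ, Finset.range_zero, Finset.sum_empty]
  norm_num [Nat.factorial]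
  ring

theorem iterTaylor_two_three (Ω : Set Point) (i j : Fin 3) (φ : Point → ℝ) (h : ℝ) (p : Point) :
    iterTaylor Ω [j, i] 3 φ h p
      = h ^ 4 * purePartial Ω i 2 (purePartial Ω j 2 φ) p
        + h ^ 6 / 12 * (purePartial Ω i 4 (purePartial Ω j 2 φ) p
          + purePartial Ω i 2 (purePartial Ω j 4 φ) p) := by
  simp only [iterTaylor, Finset.sum_range_succ, Finset.range_zero, Finset.sum_empty]
  norm_num [Nat.factorial, Finset.sum_range_succ]
  ring

theorem iterTaylor_two_four (Ω : Set Point) (i j : Fin 3) (φ : Point → ℝ) (h : ℝ) (p : Point) :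
    iterTaylor Ω [j, i] 4 φ h p
      = h ^ 4 * purePartial Ω i 2 (purePartial Ω j 2 φ) p
        + h ^ 6 / 12 * (purePartial Ω i 4 (purePartial Ω j 2 φ) p
          + purePartial Ω i 2 (purePartial Ω j 4 φ) p)
        + h ^ 8 * ((purePartial Ω i 6 (purePartial Ω j 2 φ) p
            + purePartial Ω i 2 (purePartial Ω j 6 φ) p) / 360
          + purePartial Ω i 4 (purePartial Ω j 4 φ) p / 144) := by
  simp only [iterTaylor, Finset.sum_range_succ, Finset.range_zero, Finset.sum_empty]
  norm_num [Nat.factorial, Finset.sum_range_succ]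
  ring

theorem iterTaylor_three_four (Ω : Set Point) (i j k : Fin 3) (φ : Point → ℝ) (h : ℝ)
    (p : Point) :
    iterTaylor Ω [k, j, i] 4 φ h p
      = h ^ 6 * purePartial Ω i 2 (purePartial Ω j 2 (purePartial Ω k 2 φ)) p
        + h ^ 8 / 12 * (purePartial Ω i 4 (purePartial Ω j 2 (purePartial Ω k 2 φ)) p
          + purePartial Ω i 2 (purePartial Ω j 4 (purePartial Ω k 2 φ)) p
          + purePartial Ω i 2 (purePartial Ω j 2 (purePartial Ω k 4 φ)) p) := by
  simp only [iterTaylor, Finset.sum_range_succ, Finset.range_zero, Finset.sum_empty]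
  norm_num [Nat.factorial, Finset.sum_range_succ]
  ring

/-! ### The truncation error -/

/-- The remainder of the Taylor expansion of `iterDiff h is φ p` of order `2N` in `h`. -/
def iterError (Ω : Set Point) (is : List (Fin 3)) (N : ℕ) (φ : Point → ℝ) (h : ℝ) (p : Point) : ℝ :=
  iterDiff h is φ p - iterTaylor Ω is N φ h p

/-- The scheme applied to Taylor polynomials differs from the leading error by `h ^ 8 * residual`. -/
def residual (K : ℝ) (m : ℕ → ℕ → ℕ → ℝ) (h : ℝ) : ℝ :=
  (K ^ 2 / 241920 - K ^ 4 * h ^ 2 / 7257600 + K ^ 6 * h ^ 4 / 406425600) *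
        (m 8 0 0 + m 0 8 0 + m 0 0 8)
      + K ^ 4 / 241920 *
        (m 4 2 0 + m 4 0 2 + m 2 4 0 + m 2 0 4 + m 0 4 2 + m 0 2 4)
      + (41 * K ^ 2 / 3628800 + K ^ 4 * h ^ 2 / 2419200) *
        (m 6 2 0 + m 6 0 2 + m 2 6 0 + m 2 0 6 + m 0 6 2 + m 0 2 6)
      + (K ^ 2 / 45360 + K ^ 4 * h ^ 2 / 725760) *
        (m 4 4 0 + m 4 0 4 + m 0 4 4)
      + 31 * K ^ 2 / 181440 *
        (m 4 2 2 + m 2 4 2 + m 2 2 4)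

/-- An exact pointwise identity without any smoothness hypothesis. Expansion orders 4, 3 and 2 for
`u`, `f` and `∂_i² f` match the prefactors `1`, `h ^ 2` and `h ^ 4`, so every remainder term enters
at the same total order. -/
theorem sq_mul_truncationError_sub_leadingError {Ω : Set Point} {K h : ℝ} (hh : h ≠ 0)
    {u f : Point → ℝ} {p : Point}
    (hpde : ∀ r s t : ℕ, r + s + t ≤ 6 →
      mixedPartial Ω r s t f p = mixedPartial Ω (r + 2) s t u p + mixedPartial Ω r (s + 2) t u p
        + mixedPartial Ω r s (t + 2) u p + K ^ 2 * mixedPartial Ω r s t u p) :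
    h ^ 2 * (truncationError Ω K h u f p - leadingError Ω h u f p)
      = C1 K h * (iterError Ω [0] 4 u h p + iterError Ω [1] 4 u h p + iterError Ω [2] 4 u h p)
        + (1 + K ^ 2 * h ^ 2 / 30 + K ^ 4 * h ^ 4 / 840) / 6 * (iterError Ω [1, 0] 4 u h p
          + iterError Ω [2, 1] 4 u h p + iterError Ω [2, 0] 4 u h p)
        + (1 + 17 * K ^ 2 * h ^ 2 / 252) / 30 * iterError Ω [2, 1, 0] 4 u h p
        - K ^ 4 * h ^ 4 / 20160 * h ^ 2
          * (iterError Ω [0] 3 f h p + iterError Ω [1] 3 f h p + iterError Ω [2] 3 f h p)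
        - (1 + K ^ 2 * h ^ 2 / 112) / 90 * h ^ 2 * (iterError Ω [1, 0] 3 f h p
          + iterError Ω [2, 1] 3 f h p + iterError Ω [2, 0] 3 f h p)
        - (1 - K ^ 2 * h ^ 2 / 56) / 360 * h ^ 4 * (iterError Ω [0] 2 (purePartial Ω 0 2 f) h p
          + iterError Ω [1] 2 (purePartial Ω 1 2 f) h p
          + iterError Ω [2] 2 (purePartial Ω 2 2 f) h p)
        + residual K (fun r s t => mixedPartial Ω r s t u p) h * h ^ 10 := by
  -- The derivatives at `p` are made opaque, so that the final `ring` sees only indeterminates.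
  obtain ⟨m, hm⟩ : ∃ m : ℕ → ℕ → ℕ → ℝ, m = fun r s t => mixedPartial Ω r s t u p := ⟨_, rfl⟩
  obtain ⟨F, hF'⟩ : ∃ F : ℕ → ℕ → ℕ → ℝ, F = fun r s t => mixedPartial Ω r s t f p := ⟨_, rfl⟩
  have hF : ∀ r s t : ℕ, r + s + t ≤ 6 →
      F r s t = m (r + 2) s t + m r (s + 2) t + m r s (t + 2) + K ^ 2 * m r s t := by
    subst hm hF'; exact hpde
  have f000 : F 0 0 0 = _ := hF 0 0 0 (by norm_num)
  have f200 : F 2 0 0 = _ := hF 2 0 0 (by norm_num)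
  have f020 : F 0 2 0 = _ := hF 0 2 0 (by norm_num)
  have f002 : F 0 0 2 = _ := hF 0 0 2 (by norm_num)
  have f400 : F 4 0 0 = _ := hF 4 0 0 (by norm_num)
  have f040 : F 0 4 0 = _ := hF 0 4 0 (by norm_num)
  have f004 : F 0 0 4 = _ := hF 0 0 4 (by norm_num)
  have f600 : F 6 0 0 = _ := hF 6 0 0 (by norm_num)
  have f060 : F 0 6 0 = _ := hF 0 6 0 (by norm_num)
  have f006 : F 0 0 6 = _ := hF 0 0 6 (by norm_num)
  have f220 : F 2 2 0 = _ := hF 2 2 0 (by norm_num)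
  have f022 : F 0 2 2 = _ := hF 0 2 2 (by norm_num)
  have f202 : F 2 0 2 = _ := hF 2 0 2 (by norm_num)
  have f420 : F 4 2 0 = _ := hF 4 2 0 (by norm_num)
  have f402 : F 4 0 2 = _ := hF 4 0 2 (by norm_num)
  have f240 : F 2 4 0 = _ := hF 2 4 0 (by norm_num)
  have f204 : F 2 0 4 = _ := hF 2 0 4 (by norm_num)
  have f042 : F 0 4 2 = _ := hF 0 4 2 (by norm_num)
  have f024 : F 0 2 4 = _ := hF 0 2 4 (by norm_num)
  have f222 : F 2 2 2 = _ := hF 2 2 2 (by norm_num)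
  have hu0 : u p = m 0 0 0 := by subst hm; rfl
  have hf0 : f p = F 0 0 0 := by subst hF'; rfl
  have n2 : nabla Ω 2 f p = F 2 0 0 + F 0 2 0 + F 0 0 2 := by
    subst hF'; simp only [nabla, Fin.sum_univ_three]; rfl
  have n6 : nabla Ω 6 f p = F 6 0 0 + F 0 6 0 + F 0 0 6 := by
    subst hF'; simp only [nabla, Fin.sum_univ_three]; rfl
  have hmu : ∀ r s t, mixedPartial Ω r s t u p = m r s t := by subst hm; exact fun _ _ _ => rfl
  have hmf : ∀ r s t, mixedPartial Ω r s t f p = F r s t := by subst hF'; exact fun _ _ _ => rfl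
  have u0 : iterTaylor Ω [0] 4 u h p
      = h ^ 2 * m 2 0 0 + h ^ 4 / 12 * m 4 0 0 + h ^ 6 / 360 * m 6 0 0 + h ^ 8 / 20160 * m 8 0 0 := by
    subst hm hF'; exact iterTaylor_one_four Ω 0 u h p
  have u1 : iterTaylor Ω [1] 4 u h p
      = h ^ 2 * m 0 2 0 + h ^ 4 / 12 * m 0 4 0 + h ^ 6 / 360 * m 0 6 0 + h ^ 8 / 20160 * m 0 8 0 := by
    subst hm hF'; exact iterTaylor_one_four Ω 1 u h p
  have u2 : iterTaylor Ω [2] 4 u h p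
      = h ^ 2 * m 0 0 2 + h ^ 4 / 12 * m 0 0 4 + h ^ 6 / 360 * m 0 0 6 + h ^ 8 / 20160 * m 0 0 8 := by
    subst hm hF'; exact iterTaylor_one_four Ω 2 u h p
  have u10 : iterTaylor Ω [1, 0] 4 u h p
      = h ^ 4 * m 2 2 0 + h ^ 6 / 12 * (m 4 2 0 + m 2 4 0)
        + h ^ 8 * ((m 6 2 0 + m 2 6 0) / 360 + m 4 4 0 / 144) := by
    subst hm hF'; exact iterTaylor_two_four Ω 0 1 u h p
  have u21 : iterTaylor Ω [2, 1] 4 u h p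
      = h ^ 4 * m 0 2 2 + h ^ 6 / 12 * (m 0 4 2 + m 0 2 4)
        + h ^ 8 * ((m 0 6 2 + m 0 2 6) / 360 + m 0 4 4 / 144) := by
    subst hm hF'; exact iterTaylor_two_four Ω 1 2 u h p
  have u20 : iterTaylor Ω [2, 0] 4 u h p
      = h ^ 4 * m 2 0 2 + h ^ 6 / 12 * (m 4 0 2 + m 2 0 4)
        + h ^ 8 * ((m 6 0 2 + m 2 0 6) / 360 + m 4 0 4 / 144) := by
    subst hm hF'; exact iterTaylor_two_four Ω 0 2 u h p
  have u210 : iterTaylor Ω [2, 1, 0] 4 u h p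
      = h ^ 6 * m 2 2 2 + h ^ 8 / 12 * (m 4 2 2 + m 2 4 2 + m 2 2 4) := by
    subst hm hF'; exact iterTaylor_three_four Ω 0 1 2 u h p
  have g0 : iterTaylor Ω [0] 3 f h p
      = h ^ 2 * F 2 0 0 + h ^ 4 / 12 * F 4 0 0 + h ^ 6 / 360 * F 6 0 0 := by
    subst hm hF'; exact iterTaylor_one_three Ω 0 f h p
  have g1 : iterTaylor Ω [1] 3 f h p
      = h ^ 2 * F 0 2 0 + h ^ 4 / 12 * F 0 4 0 + h ^ 6 / 360 * F 0 6 0 := by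
    subst hm hF'; exact iterTaylor_one_three Ω 1 f h p
  have g2 : iterTaylor Ω [2] 3 f h p
      = h ^ 2 * F 0 0 2 + h ^ 4 / 12 * F 0 0 4 + h ^ 6 / 360 * F 0 0 6 := by
    subst hm hF'; exact iterTaylor_one_three Ω 2 f h p
  have g10 : iterTaylor Ω [1, 0] 3 f h p
      = h ^ 4 * F 2 2 0 + h ^ 6 / 12 * (F 4 2 0 + F 2 4 0) := by
    subst hm hF'; exact iterTaylor_two_three Ω 0 1 f h p
  have g21 : iterTaylor Ω [2, 1] 3 f h p
      = h ^ 4 * F 0 2 2 + h ^ 6 / 12 * (F 0 4 2 + F 0 2 4) := by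
    subst hm hF'; exact iterTaylor_two_three Ω 1 2 f h p
  have g20 : iterTaylor Ω [2, 0] 3 f h p
      = h ^ 4 * F 2 0 2 + h ^ 6 / 12 * (F 4 0 2 + F 2 0 4) := by
    subst hm hF'; exact iterTaylor_two_three Ω 0 2 f h p
  have k0 : iterTaylor Ω [0] 2 (purePartial Ω 0 2 f) h p
      = h ^ 2 * F 4 0 0 + h ^ 4 / 12 * F 6 0 0 := by
    subst hm hF'; exact iterTaylor_one_two Ω 0 (purePartial Ω 0 2 f) h p
  have k1 : iterTaylor Ω [1] 2 (purePartial Ω 1 2 f) h p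
      = h ^ 2 * F 0 4 0 + h ^ 4 / 12 * F 0 6 0 := by
    subst hm hF'; exact iterTaylor_one_two Ω 1 (purePartial Ω 1 2 f) h p
  have k2 : iterTaylor Ω [2] 2 (purePartial Ω 2 2 f) h p
      = h ^ 2 * F 0 0 4 + h ^ 4 / 12 * F 0 0 6 := by
    subst hm hF'; exact iterTaylor_one_two Ω 2 (purePartial Ω 2 2 f) h p
  rw [truncationError, mul_sub, mul_sub, sq_mul_schemeLHS hh, sq_mul_schemeRHS hh]
  simp only [leadingError, iterError, residual, u0, u1, u2, u10, u21, u20, u210, g0, g1, g2,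
    g10, g21, g20, k0, k1, k2, hu0, hf0, n2, n6, hmu, hmf, f000, f200, f020, f002, f400, f040,
    f004, f600, f060, f006, f220, f022, f202, f420, f402, f240, f204, f042, f024, f222, C1, C4,
    D1, D4]
  ring

/-! ### Uniform bounds over admissible steps and nodes -/

/-- Pairs of a step `h > 0` and a node whose `27`-point stencil lies in `Ω`. -/
def admissible (Ω : Set Point) : Set (ℝ × Point) := {x | 0 < x.1 ∧ stencil27 x.1 x.2 ⊆ Ω}

theorem mem_of_mem_admissible {Ω : Set Point} {x : ℝ × Point} (hx : x ∈ admissible Ω) :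
    x.2 ∈ Ω := hx.2 fun _ => Or.inr (Or.inl rfl)

/-- The centre and a neighbour at distance `h` both lie in `Ω`, so its diameter bounds the step.
Hence the estimates hold for every admissible step, not only for small ones. -/
theorem exists_step_le {Ω : Set Point} (hK : IsCompact Ω) :
    ∃ H, 0 ≤ H ∧ ∀ x ∈ admissible Ω, x.1 ≤ H := by
  refine ⟨Metric.diam Ω, Metric.diam_nonneg, fun x hx => ?_⟩
  have h1 : x.2 + Pi.single 0 x.1 ∈ Ω := hx.2 fun i => by by_cases hi : i = 0 <;> simp [hi]
  have h2 := Metric.dist_le_diam_of_mem hK.isBounded h1 (mem_of_mem_admissible hx)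
  rw [dist_eq_norm, add_sub_cancel_left, Pi.norm_single] at h2
  exact (le_abs_self _).trans h2

theorem isBigO_admissible_of_continuous {Ω : Set Point} (hK : IsCompact Ω) {c : ℝ → ℝ}
    (hc : Continuous c) :
    (fun x : ℝ × Point => c x.1) =O[𝓟 (admissible Ω)] fun _ => (1 : ℝ) := by
  obtain ⟨H, -, hH⟩ := exists_step_le hK
  obtain ⟨C, hC⟩ := (isCompact_Icc (a := (0 : ℝ)) (b := H)).exists_bound_of_continuousOn
    hc.continuousOn
  refine isBigO_iff.2 ⟨C, eventually_principal.2 fun x hx => ?_⟩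
  simpa using hC x.1 ⟨hx.1.le, hH x hx⟩

theorem isBigO_admissible_of_continuousOn {Ω : Set Point} (hK : IsCompact Ω) {φ : Point → ℝ}
    (hφ : ContinuousOn φ Ω) :
    (fun x : ℝ × Point => φ x.2) =O[𝓟 (admissible Ω)] fun _ => (1 : ℝ) := by
  obtain ⟨C, hC⟩ := hK.exists_bound_of_continuousOn hφ
  refine isBigO_iff.2 ⟨C, eventually_principal.2 fun x hx => ?_⟩
  simpa using hC x.2 (mem_of_mem_admissible hx)

theorem exists_bound_of_isBigO_admissible {Ω : Set Point} {e : ℝ × Point → ℝ} {g : ℝ → ℝ}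
    (h : e =O[𝓟 (admissible Ω)] fun x => g x.1) (hg : ∀ t, 0 ≤ t → 0 ≤ g t) :
    ∃ C, 0 ≤ C ∧ ∀ (h : ℝ) (p : Point), 0 < h → stencil27 h p ⊆ Ω → |e (h, p)| ≤ C * g h := by
  obtain ⟨C, hC, hb⟩ := h.exists_nonneg
  refine ⟨C, hC, fun h p hh hst => ?_⟩
  have := eventually_principal.1 hb.bound (h, p) ⟨hh, hst⟩
  rwa [Real.norm_eq_abs, Real.norm_eq_abs, abs_of_nonneg (hg h hh.le)] at this

theorem HasGauge.isBigO_iterError {Ω : Set Point} (hΩ : UniqueDiffOn ℝ Ω)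
    (hc : Convex ℝ Ω) {ω : ℝ → ℝ} (hω : IsGauge ω) {is : List (Fin 3)}
    (his : ∀ (h : ℝ) (p : Point), stencil27 h p ⊆ Ω → p ∈ iterDomain h is Ω) {N : ℕ}
    {φ : Point → ℝ} (hφ : HasGauge Ω ω (2 * N) φ) :
    (fun x : ℝ × Point => iterError Ω is N φ x.1 x.2) =O[𝓟 (admissible Ω)]
      fun x => ω x.1 * x.1 ^ (2 * N) := by
  obtain ⟨C, -, hb⟩ := hφ.exists_iterDiff_bound hΩ hc hω is
  refine isBigO_iff.2 ⟨C, eventually_principal.2 fun x hx => ?_⟩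
  have := hb x.1 x.2 hx.1.le (his _ _ hx.2)
  rwa [Real.norm_eq_abs, Real.norm_eq_abs,
    abs_of_nonneg (mul_nonneg (hω.nonneg hx.1.le) (pow_nonneg hx.1.le _))]

theorem isBigO_residual {Ω : Set Point} (hΩ : UniqueDiffOn ℝ Ω) (hK : IsCompact Ω) (K : ℝ)
    {u : Point → ℝ} (hu : ContDiffOn ℝ (8 : ℕ) u Ω) :
    (fun x : ℝ × Point => residual K (fun r s t => mixedPartial Ω r s t u x.2) x.1)
      =O[𝓟 (admissible Ω)] fun _ => (1 : ℝ) := by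
  have hm : ∀ r s t : ℕ, r + s + t ≤ 8 → (fun x : ℝ × Point => mixedPartial Ω r s t u x.2)
      =O[𝓟 (admissible Ω)] fun _ => (1 : ℝ) := fun r s t hrst =>
    isBigO_admissible_of_continuousOn hK
      (contDiffOn_mixedPartial (n := 0) hΩ (hu.of_le (by norm_cast; omega))).continuousOn
  have hmul : ∀ {c : ℝ → ℝ} {e : ℝ × Point → ℝ}, Continuous c →
      e =O[𝓟 (admissible Ω)] (fun _ => (1 : ℝ)) →
      (fun x => c x.1 * e x) =O[𝓟 (admissible Ω)] fun _ => (1 : ℝ) := fun hc he => by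
    simpa using (isBigO_admissible_of_continuous hK hc).mul he
  have three : ∀ r₁ s₁ t₁ r₂ s₂ t₂ r₃ s₃ t₃ : ℕ, r₁ + s₁ + t₁ ≤ 8 → r₂ + s₂ + t₂ ≤ 8 →
      r₃ + s₃ + t₃ ≤ 8 → (fun x : ℝ × Point => mixedPartial Ω r₁ s₁ t₁ u x.2
        + mixedPartial Ω r₂ s₂ t₂ u x.2 + mixedPartial Ω r₃ s₃ t₃ u x.2)
      =O[𝓟 (admissible Ω)] fun _ => (1 : ℝ) := fun r₁ s₁ t₁ r₂ s₂ t₂ r₃ s₃ t₃ h₁ h₂ h₃ =>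
    ((hm _ _ _ h₁).add (hm _ _ _ h₂)).add (hm _ _ _ h₃)
  have six : ∀ a b : ℕ, a + b ≤ 8 → (fun x : ℝ × Point => mixedPartial Ω a b 0 u x.2
        + mixedPartial Ω a 0 b u x.2 + mixedPartial Ω b a 0 u x.2 + mixedPartial Ω b 0 a u x.2
        + mixedPartial Ω 0 a b u x.2 + mixedPartial Ω 0 b a u x.2)
      =O[𝓟 (admissible Ω)] fun _ => (1 : ℝ) := fun a b hab =>
    (((three a b 0 a 0 b b a 0 (by omega) (by omega) (by omega)).add
      (hm b 0 a (by omega))).add (hm 0 a b (by omega))).add (hm 0 b a (by omega))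
  have total := ((((hmul
      (c := fun h => K ^ 2 / 241920 - K ^ 4 * h ^ 2 / 7257600 + K ^ 6 * h ^ 4 / 406425600)
      (by fun_prop) (three 8 0 0 0 8 0 0 0 8 (by simp) (by simp) (by simp))).add
    (hmul (c := fun _ => K ^ 4 / 241920) (by fun_prop) (six 4 2 (by simp)))).add
    (hmul (c := fun h => 41 * K ^ 2 / 3628800 + K ^ 4 * h ^ 2 / 2419200) (by fun_prop)
      (six 6 2 (by simp)))).add
    (hmul (c := fun h => K ^ 2 / 45360 + K ^ 4 * h ^ 2 / 725760) (by fun_prop)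
      (three 4 4 0 4 0 4 0 4 4 (by simp) (by simp) (by simp)))).add
    (hmul (c := fun _ => 31 * K ^ 2 / 181440) (by fun_prop)
      (three 4 2 2 2 4 2 2 2 4 (by simp) (by simp) (by simp)))
  exact total

/-- Each term of the algebraic identity is `O(ω h * h ^ 8)` over admissible pairs; dividing by the
auxiliary factor `h ^ 2` leaves `ω h * h ^ 6`. -/
theorem exists_truncationError_sub_leadingError_bound {Ω : Set Point} (hΩ : UniqueDiffOn ℝ Ω)
    (hcl : Ω ⊆ closure (interior Ω)) (hc : Convex ℝ Ω) (hK : IsCompact Ω) {K : ℝ}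
    {u f : Point → ℝ} (hpde : IsHelmholtzSolution Ω K u f) {ω : ℝ → ℝ} (hω : IsGauge ω)
    (hu : HasGauge Ω ω 8 u) :
    ∃ C, 0 ≤ C ∧ ∀ (h : ℝ) (p : Point), 0 < h → stencil27 h p ⊆ Ω →
      |truncationError Ω K h u f p - leadingError Ω h u f p| ≤ C * (ω h * h ^ 6) := by
  have hf : HasGauge Ω ω 6 f := hpde.hasGauge hΩ hc hK hω hu
  have hst := fun h p hs => mem_iterDomain_of_stencil27_subset (Ω := Ω) (h := h) (p := p) hs
  have big : ∀ {is : List (Fin 3)} {N : ℕ} {φ : Point → ℝ},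
      (∀ (h : ℝ) (p : Point), stencil27 h p ⊆ Ω → p ∈ iterDomain h is Ω) →
      HasGauge Ω ω (2 * N) φ → (fun x : ℝ × Point => iterError Ω is N φ x.1 x.2)
        =O[𝓟 (admissible Ω)] fun x => ω x.1 * x.1 ^ (2 * N) :=
    fun his hφ => hφ.isBigO_iterError hΩ hc hω his
  have i1 := fun (i : Fin 3) h p hs => (hst h p hs).1 i
  have i10 := fun h p hs => (hst h p hs).2.1
  have i21 := fun h p hs => (hst h p hs).2.2.1
  have i20 := fun h p hs => (hst h p hs).2.2.2.1
  have i210 := fun h p hs => (hst h p hs).2.2.2.2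
  have hu' : HasGauge Ω ω (2 * 4) u := hu
  have hf' : HasGauge Ω ω (2 * 3) f := hf
  have hg : ∀ i, HasGauge Ω ω (2 * 2) (purePartial Ω i 2 f) := fun i =>
    HasGauge.purePartial (n := 4) (k := 2) hf i
  have hmul : ∀ {c : ℝ → ℝ} {e : ℝ × Point → ℝ} {n : ℕ} (k : ℕ), n + k = 8 → Continuous c →
      e =O[𝓟 (admissible Ω)] (fun x => ω x.1 * x.1 ^ n) →
      (fun x => c x.1 * x.1 ^ k * e x) =O[𝓟 (admissible Ω)] fun x => ω x.1 * x.1 ^ 8 := by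
    intro c e n k hnk hc he
    refine (((isBigO_admissible_of_continuous hK hc).mul
      (isBigO_refl (fun x : ℝ × Point => x.1 ^ k) _)).mul he).congr_right fun x => ?_
    rw [← hnk, pow_add]
    ring
  have hmul0 : ∀ {c : ℝ → ℝ} {e : ℝ × Point → ℝ}, Continuous c →
      e =O[𝓟 (admissible Ω)] (fun x => ω x.1 * x.1 ^ 8) →
      (fun x => c x.1 * e x) =O[𝓟 (admissible Ω)] fun x => ω x.1 * x.1 ^ 8 := by
    intro c e hc he
    simpa using hmul 0 rfl hc he
  -- The residual is bounded and `h ^ 10 = h ^ 2 * h ^ 8 ≤ ω h * h ^ 8`.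
  have hres : (fun x : ℝ × Point =>
      residual K (fun r s t => mixedPartial Ω r s t u x.2) x.1 * x.1 ^ 10)
      =O[𝓟 (admissible Ω)] fun x => ω x.1 * x.1 ^ 8 := by
    have hpow : (fun x : ℝ × Point => x.1 ^ 10) =O[𝓟 (admissible Ω)]
        fun x => ω x.1 * x.1 ^ 8 := by
      refine isBigO_iff.2 ⟨1, eventually_principal.2 fun x hx => ?_⟩
      have h8 : 0 ≤ x.1 ^ 8 := pow_nonneg hx.1.le 8
      rw [one_mul, Real.norm_eq_abs, Real.norm_eq_abs, abs_of_nonneg (pow_nonneg hx.1.le 10),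
        abs_of_nonneg (mul_nonneg (hω.nonneg hx.1.le) h8), show x.1 ^ 10 = x.1 ^ 2 * x.1 ^ 8 by ring]
      exact mul_le_mul_of_nonneg_right (hω.sq_le _ hx.1.le) h8
    simpa using (isBigO_residual hΩ hK K hu.contDiffOn).mul hpow
  have c1 : Continuous (C1 K) := by unfold C1; fun_prop
  have total := ((((((hmul0 c1
    (((big (i1 0) hu').add (big (i1 1) hu')).add (big (i1 2) hu'))).add
    (hmul0 (c := fun h => (1 + K ^ 2 * h ^ 2 / 30 + K ^ 4 * h ^ 4 / 840) / 6) (by fun_prop)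
      (((big i10 hu').add (big i21 hu')).add (big i20 hu')))).add
    (hmul0 (c := fun h => (1 + 17 * K ^ 2 * h ^ 2 / 252) / 30) (by fun_prop) (big i210 hu'))).sub
    (hmul (c := fun h => K ^ 4 * h ^ 4 / 20160) 2 rfl (by fun_prop)
      (((big (i1 0) hf').add (big (i1 1) hf')).add (big (i1 2) hf')))).sub
    (hmul (c := fun h => (1 + K ^ 2 * h ^ 2 / 112) / 90) 2 rfl (by fun_prop)
      (((big i10 hf').add (big i21 hf')).add (big i20 hf')))).sub
    (hmul (c := fun h => (1 - K ^ 2 * h ^ 2 / 56) / 360) 4 rfl (by fun_prop)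
      (((big (i1 0) (hg 0)).add (big (i1 1) (hg 1))).add (big (i1 2) (hg 2))))).add hres
  obtain ⟨C, hC, hb⟩ := exists_bound_of_isBigO_admissible (g := fun h => ω h * h ^ 8) total
    fun t ht => mul_nonneg (hω.nonneg ht) (pow_nonneg ht 8)
  refine ⟨C, hC, fun h p hh hs => ?_⟩
  have key := hb h p hh hs
  have hp : p ∈ Ω := mem_of_mem_admissible (x := (h, p)) ⟨hh, hs⟩
  beta_reduce at key
  rw [← sq_mul_truncationError_sub_leadingError hh.ne' fun r s t hrst =>
    hpde.mixedPartial_eq hΩ hcl (hu.contDiffOn.of_le (by norm_cast; omega)) hp,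
    abs_mul, abs_of_nonneg (sq_nonneg h)] at key
  refine le_of_mul_le_mul_left (key.trans_eq ?_) (pow_pos hh 2)
  ring

theorem exists_leadingError_bound {Ω : Set Point} (hΩ : UniqueDiffOn ℝ Ω) (hK : IsCompact Ω)
    {u f : Point → ℝ} (hu : ContDiffOn ℝ (8 : ℕ) u Ω) (hf : ContDiffOn ℝ (6 : ℕ) f Ω) :
    ∃ C, 0 ≤ C ∧ ∀ (h : ℝ) (p : Point), 0 < h → stencil27 h p ⊆ Ω →
      |leadingError Ω h u f p| ≤ C * h ^ 6 := by
  have hm : ∀ r s t : ℕ, r + s + t ≤ 8 → (fun x : ℝ × Point => mixedPartial Ω r s t u x.2)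
      =O[𝓟 (admissible Ω)] fun _ => (1 : ℝ) := fun r s t hrst =>
    isBigO_admissible_of_continuousOn hK
      (contDiffOn_mixedPartial (n := 0) hΩ (hu.of_le (by norm_cast; omega))).continuousOn
  have hF : ∀ r s t : ℕ, r + s + t ≤ 6 → (fun x : ℝ × Point => mixedPartial Ω r s t f x.2)
      =O[𝓟 (admissible Ω)] fun _ => (1 : ℝ) := fun r s t hrst =>
    isBigO_admissible_of_continuousOn hK
      (contDiffOn_mixedPartial (n := 0) hΩ (hf.of_le (by norm_cast; omega))).continuousOn
  have hn : (fun x : ℝ × Point => nabla Ω 6 f x.2) =O[𝓟 (admissible Ω)] fun _ => (1 : ℝ) := by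
    unfold nabla
    exact IsBigO.fun_sum fun i _ => isBigO_admissible_of_continuousOn hK
      (contDiffOn_purePartial (n := 0) hΩ hf i).continuousOn
  have hmul : ∀ {e : ℝ × Point → ℝ} (a b : ℝ), e =O[𝓟 (admissible Ω)] (fun _ => (1 : ℝ)) →
      (fun x => a * x.1 ^ 6 / b * e x) =O[𝓟 (admissible Ω)] fun x => x.1 ^ 6 := by
    intro e a b he
    have h1 : (fun x : ℝ × Point => a * x.1 ^ 6 / b) =O[𝓟 (admissible Ω)] fun x => x.1 ^ 6 :=
      (isBigO_const_mul_self (a / b) _ _).congr_left fun x => by ring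
    simpa using h1.mul he
  have total := (((hmul 1 3024 (((hm 4 4 0 (by norm_num)).add (hm 0 4 4 (by norm_num))).add
    (hm 4 0 4 (by norm_num)))).sub
    (hmul 31 60480 ((((((hF 4 2 0 (by norm_num)).add (hF 2 4 0 (by norm_num))).add
      (hF 0 4 2 (by norm_num))).add (hF 0 2 4 (by norm_num))).add (hF 4 0 2 (by norm_num))).add
      (hF 2 0 4 (by norm_num))))).add (hmul 59 30240 (hF 2 2 2 (by norm_num)))).sub
    (hmul 11 60480 hn)
  obtain ⟨C, hC, hb⟩ := exists_bound_of_isBigO_admissible (g := fun h => h ^ 6) total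
    fun t ht => pow_nonneg ht 6
  refine ⟨C, hC, fun h p hh hs => ?_⟩
  have key := hb h p hh hs
  simp only [one_mul] at key
  exact key

end Helmholtz3D

end

/-! ### The theorem on a closed box -/

theorem mainTheorem6 (a b : Helmholtz3D.Point) (hab : ∀ i, a i < b i) (K : ℝ)
    (u f : Helmholtz3D.Point → ℝ)
    (hu : ContDiffOn ℝ 8 u (Set.Icc a b))
    (hpde : Helmholtz3D.IsHelmholtzSolution (Set.Icc a b) K u f) :
    -- the scheme is compact: it only uses data at the points of the 27-point stencil
    (∀ (h : ℝ) (p : Helmholtz3D.Point) (φ ψ : Helmholtz3D.Point → ℝ),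
      Set.EqOn φ ψ (Helmholtz3D.stencil27 h p) →
        Helmholtz3D.schemeLHS K h φ p = Helmholtz3D.schemeLHS K h ψ p ∧
        ((∀ i, Set.EqOn (Helmholtz3D.purePartial (Set.Icc a b) i 2 φ)
            (Helmholtz3D.purePartial (Set.Icc a b) i 2 ψ) (Helmholtz3D.stencil27 h p)) →
          Helmholtz3D.schemeRHS (Set.Icc a b) K h φ p
            = Helmholtz3D.schemeRHS (Set.Icc a b) K h ψ p)) ∧
    -- consistency of sixth order, uniformly in the node
    (∃ C : ℝ, ∀ (h : ℝ) (p : Helmholtz3D.Point), 0 < h →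
      Helmholtz3D.stencil27 h p ⊆ Set.Icc a b →
        |Helmholtz3D.truncationError (Set.Icc a b) K h u f p| ≤ C * h ^ 6 ∧
        |Helmholtz3D.leadingError (Set.Icc a b) h u f p| ≤ C * h ^ 6) ∧
    -- the leading term of the truncation error, for `u` of class `C^8`
    (∀ ε : ℝ, 0 < ε → ∃ h₀ : ℝ, 0 < h₀ ∧ ∀ (h : ℝ) (p : Helmholtz3D.Point), 0 < h → h < h₀ →
      Helmholtz3D.stencil27 h p ⊆ Set.Icc a b →
        |Helmholtz3D.truncationError (Set.Icc a b) K h u f p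
          - Helmholtz3D.leadingError (Set.Icc a b) h u f p| ≤ ε * h ^ 6) ∧
    -- the remainder is of order `h^8` for `u` of class `C^10`
    (ContDiffOn ℝ 10 u (Set.Icc a b) →
      ∃ C : ℝ, ∀ (h : ℝ) (p : Helmholtz3D.Point), 0 < h →
        Helmholtz3D.stencil27 h p ⊆ Set.Icc a b →
          |Helmholtz3D.truncationError (Set.Icc a b) K h u f p
            - Helmholtz3D.leadingError (Set.Icc a b) h u f p| ≤ C * h ^ 8) := by
  have hΩ : UniqueDiffOn ℝ (Set.Icc a b) := by
    refine uniqueDiffOn_convex (convex_Icc a b) ?_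
    rw [← Set.pi_univ_Icc, interior_pi_set Set.finite_univ]
    refine Set.univ_pi_nonempty_iff.2 fun i => ?_
    rw [interior_Icc]
    exact Set.nonempty_Ioo.2 (hab i)
  have hcl : Set.Icc a b ⊆ closure (interior (Set.Icc a b)) := by
    rw [← Set.pi_univ_Icc, interior_pi_set Set.finite_univ, closure_pi_set]
    exact Set.pi_mono fun i _ => (closure_interior_Icc (hab i).ne).ge
  have hc : Convex ℝ (Set.Icc a b) := convex_Icc a b
  have hK : IsCompact (Set.Icc a b) := isCompact_Icc
  obtain ⟨ω, hω, hlim, hg⟩ := Helmholtz3D.exists_gauge hΩ hK (n := 8) hu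
  obtain ⟨C, hC, hb⟩ :=
    Helmholtz3D.exists_truncationError_sub_leadingError_bound hΩ hcl hc hK hpde hω hg
  refine ⟨fun h p φ ψ he => ⟨Helmholtz3D.schemeLHS_congr he, Helmholtz3D.schemeRHS_congr he⟩,
    ?_, fun ε hε => ?_, fun hu10 => ?_⟩
  · obtain ⟨H, hH0, hH⟩ := Helmholtz3D.exists_step_le hK
    obtain ⟨C', hC', hb'⟩ := Helmholtz3D.exists_leadingError_bound hΩ hK (u := u) (f := f) hu
      (hpde.hasGauge hΩ hc hK hω hg).contDiffOn
    have hωH := hω.nonneg hH0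
    -- Admissible steps are at most `H`, so `ω h ≤ ω H`; `C'` bounds the leading error.
    refine ⟨C * ω H + C', fun h p hh hs => ⟨?_, (hb' h p hh hs).trans ?_⟩⟩
    · have h1 : C * (ω h * h ^ 6) ≤ C * ω H * h ^ 6 := by
        rw [mul_assoc]
        exact mul_le_mul_of_nonneg_left (mul_le_mul_of_nonneg_right
          (hω.mono hh.le hH0 (hH (h, p) ⟨hh, hs⟩)) (by positivity)) hC
      have h2 := abs_add_le (Helmholtz3D.truncationError (Set.Icc a b) K h u f p
        - Helmholtz3D.leadingError (Set.Icc a b) h u f p)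
        (Helmholtz3D.leadingError (Set.Icc a b) h u f p)
      rw [sub_add_cancel] at h2
      have h3 := hb h p hh hs
      have h4 := hb' h p hh hs
      linarith
    · exact mul_le_mul_of_nonneg_right (by linarith [mul_nonneg hC hωH]) (by positivity)
  · have hlim' : Filter.Tendsto (fun h => C * ω h) (nhdsWithin 0 (Set.Ioi 0)) (nhds 0) := by
      simpa using hlim.const_mul C
    -- The threshold depends only on the gauge and `C`, which gives uniformity in the node.
    obtain ⟨h₀, hh₀, hsub⟩ := mem_nhdsGT_iff_exists_Ioo_subset.1 (hlim'.eventually_lt_const hε)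
    refine ⟨h₀, hh₀, fun h p hh hlt hs => (hb h p hh hs).trans ?_⟩
    rw [← mul_assoc]
    exact mul_le_mul_of_nonneg_right (le_of_lt (hsub ⟨hh, hlt⟩)) (by positivity)
  -- The same estimate with the gauge `h ^ 2`, affordable because two further derivatives of `u` are
  -- bounded.
  · obtain ⟨C', -, hb'⟩ := Helmholtz3D.exists_truncationError_sub_leadingError_bound hΩ hcl hc hK
      hpde Helmholtz3D.isGauge_sq (Helmholtz3D.hasGauge_sq (n := 8) hΩ hc hK hu10)
    refine ⟨C', fun h p hh hs => (hb' h p hh hs).trans_eq ?_⟩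
    ring
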